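/- Let $n\ge 1$ and let $s=(s_1,\dots,s_n)$ be a sequence of positive integers with $s_{i+1}-s_i\in\{0,1\}$ for $1\le i<n$; put $s_{n+1}:=s_n+1$. Let $$P_n^s=\Big\{\lambda\in\mathbb R^n: 0\le \tfrac{\lambda_1}{s_1}\le\cdots\le\tfrac{\lambda_n}{s_n},\ \lambda_n\le s_n\Big\}$$ be the $s$-lecture hall simplex, and let $A_n^s\subset\mathbb R^{n+1}$ be its image under the injective affine map $$\lambda\mapsto(\lambda_1,\ \lambda_2-\lambda_1,\ \dots,\ \lambda_n-\lambda_{n-1},\ s_{n+1}-\lambda_n),$$ which restricts to a bijection $P_n^s\cap\mathbb Z^n\to A_n^s\cap\mathbb Z^{n+1}$. An $s$-lecture hall multiset is a multiset $I$ with elements in $\{1,\dots,n+1\}$ whose multiplicity vector $\mathrm{mult}(I)=(\mathrm{mult}_I(1),\dots,\mathrm{mult}_I(n+1))$ lies in $A_n^s$. The map $I\mapsto \mathrm{mult}(I)$ is a bijection from these multisets to the lattice points of $A_n^s$ (hence they also label the lattice points of $P_n^s$). For a field $K$ let $K[\mathbf x]=K[x_I: I \text{ an } s\text{-lecture hall multiset}]$.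 For a lattice polytope $Q\subset\mathbb R^N$ whose lattice points $a_I$ are labelled by the $s$-lecture hall multisets, its toric ideal is the kernel of the $K$-algebra homomorphism $K[\mathbf x]\to K[t_1^{\pm1},\dots,t_{N+1}^{\pm1}]$, $x_I\mapsto t^{(a_I,1)}$. Order multisets by the lexicographic order of their multiplicity vectors, and compare two collections (repetitions allowed) of $k$ multisets by listing each in decreasing order and comparing the two lists lexicographically. For a pair $\{I,J\}$ of $s$-lecture hall multisets, possibly equal, let $\{I^-,J^-\}$ be the smallest pair of $s$-lecture hall multisets whose multiunion equals that of $\{I,J\}$. **Theorem.** The toric ideals of $P_n^s$ and of $A_n^s$ in $K[\mathbf x]$ coincide; denote this ideal by $\mathcal I_n^s$. There exists a term order $\succ$ on $K[\mathbf x]$ such that the set of homogeneous quadratic binomials $$G=\{\underline{x_Ix_J}-x_{I^-}x_{J^-}: I, J \text{ are } s\text{-lecture hall multisets with } \{I,J\}\ne\{I^-,J^-\}\}$$ is a reduced Gröbner basis of $\mathcal I_n^s$ with respect to $\succ$, and the initial term of each of these binomials is the underlined monomial $x_Ix_J$. In particular, the initial ideal $\mathrm{in}_\succ(\mathcal I_n^s)$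 is generated by the underlined monomials, all of which are square-free. -/

import Mathlib

noncomputable section

namespace LectureHall

open MvPolynomial

/-! Toric ideals of polytopes. -/

/-- The set of lattice points of a subset `Q` of `ℝ ^ N`. -/
def latticePoints {N : ℕ} (Q : Set (Fin N → ℝ)) : Set (Fin N → ℤ) :=
  {z | (fun i => (z i : ℝ)) ∈ Q}

/-- The toric ideal of `Q ⊂ ℝ ^ N`, whose lattice points are labelled as `a i`, `i : ι`:
the kernel of the homomorphism `x_i ↦ t ^ (a i, 1)` from the polynomial ring `K[x_i : i ∈ ι]` to the
ring of Laurent polynomials in `t_1, …, t_{N+1}`, that is, to the group algebra of `ℤ ^ (N+1)`. -/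
def toricIdeal (K : Type*) [Field K] {N : ℕ} {Q : Set (Fin N → ℝ)} {ι : Type*}
    (a : ι ≃ latticePoints Q) : Ideal (MvPolynomial ι K) :=
  RingHom.ker
    (aeval (fun i : ι =>
        (AddMonoidAlgebra.single (Fin.snoc (α := fun _ => ℤ) (a i : Fin N → ℤ) 1) (1 : K) :
          AddMonoidAlgebra K (Fin (N + 1) → ℤ))) :
      MvPolynomial ι K →ₐ[K] AddMonoidAlgebra K (Fin (N + 1) → ℤ))

/-! Gröbner bases. -/

section Groebner

variable {σ K : Type*} [Field K]

/-- The ideal generated by the initial terms of all elements of `I`. -/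
def initialIdeal (m : MonomialOrder σ) (I : Ideal (MvPolynomial σ K)) :
    Ideal (MvPolynomial σ K) :=
  Ideal.span (m.leadingTerm '' (I : Set (MvPolynomial σ K)))

structure IsGroebnerBasis (m : MonomialOrder σ) (G : Set (MvPolynomial σ K))
    (I : Ideal (MvPolynomial σ K)) : Prop where
  finite : G.Finite
  subset : G ⊆ (I : Set (MvPolynomial σ K))
  span_eq : Ideal.span (m.leadingTerm '' G) = initialIdeal m I

/-- The initial terms of the elements of `G` are monomials (with coefficient one), and they form a
minimal generating set of the initial ideal. -/
structure IsMinimalGroebnerBasis (m : MonomialOrder σ) (G : Set (MvPolynomial σ K))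
    (I : Ideal (MvPolynomial σ K)) : Prop extends IsGroebnerBasis m G I where
  monic : ∀ g ∈ G, m.Monic g
  minimal : ∀ g ∈ G, m.leadingTerm g ∉ Ideal.span (m.leadingTerm '' (G \ {g}))

/-- No non-initial term of an element of `G` is divisible by an initial monomial of `G`. -/
structure IsReducedGroebnerBasis (m : MonomialOrder σ) (G : Set (MvPolynomial σ K))
    (I : Ideal (MvPolynomial σ K)) : Prop extends IsMinimalGroebnerBasis m G I where
  reduced : ∀ g ∈ G, ∀ h ∈ G, ∀ c ∈ g.support, c ≠ m.degree g → ¬ m.degree h ≤ c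

end Groebner

/-! Lecture hall simplices. A sequence `s : Fin (n + 1) → ℕ` has length `n + 1`. -/

/-- A sequence of positive integers whose first differences lie in `{0, 1}`. -/
structure IsZeroOneSeq {n : ℕ} (s : Fin (n + 1) → ℕ) : Prop where
  pos : ∀ i, 0 < s i
  le_succ : ∀ i : Fin n, s i.castSucc ≤ s i.succ
  succ_le : ∀ i : Fin n, s i.succ ≤ s i.castSucc + 1

variable {n : ℕ}

/-- The cone `0 ≤ x_1 / s_1 ≤ x_2 / s_2 ≤ ⋯`. -/
def cone (s : Fin (n + 1) → ℕ) : Set (Fin (n + 1) → ℝ) :=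
  {x | 0 ≤ x 0 / (s 0 : ℝ) ∧ ∀ i : Fin n,
    x i.castSucc / (s i.castSucc : ℝ) ≤ x i.succ / (s i.succ : ℝ)}

/-- The lecture hall simplex. -/
def simplexP (s : Fin (n + 1) → ℕ) : Set (Fin (n + 1) → ℝ) :=
  {x | x ∈ cone s ∧ x (Fin.last n) ≤ (s (Fin.last n) : ℝ)}

/-- The map `x_i ↦ x_i - x_{i-1}`, where `x_0 := 0`. -/
def diffMap {R : Type*} [Ring R] (x : Fin (n + 1) → R) : Fin (n + 1) → R :=
  fun i => x i - (Fin.cons 0 x : Fin (n + 2) → R) i.castSucc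

/-- The map that appends the coordinate `(s_last + 1) - ∑ x_i`. -/
def homogenize {R : Type*} [Ring R] (s : Fin (n + 1) → ℕ) (x : Fin (n + 1) → R) :
    Fin (n + 2) → R :=
  Fin.snoc x ((s (Fin.last n) : R) + 1 - ∑ i, x i)

/-- The image of the lecture hall simplex under `homogenize ∘ diffMap`. -/
def simplexA (s : Fin (n + 1) → ℕ) : Set (Fin (n + 2) → ℝ) :=
  (fun x => homogenize s (diffMap x)) '' simplexP s

/-- The multiplicity vector of a multiset. -/
def mult {N : ℕ} (I : Multiset (Fin N)) : Fin N → ℤ := fun i => (I.count i : ℤ)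

/-- The `s`-lecture hall multisets: those whose multiplicity vector is a lattice point of
`simplexA s`. -/
abbrev LHMultiset (s : Fin (n + 1) → ℕ) : Type :=
  {I : Multiset (Fin (n + 2)) // mult I ∈ latticePoints (simplexA s)}

/-! The labellings of the lattice points of the two simplices by lecture hall multisets. -/

theorem homogenize_diffMap_castSucc {R : Type*} [Ring R] (s : Fin (n + 1) → ℕ)
    (x : Fin (n + 1) → R) (i : Fin (n + 1)) :
    homogenize s (diffMap x) i.castSucc =
      x i - (Fin.cons 0 x : Fin (n + 2) → R) i.castSucc := by
  simp [homogenize, diffMap]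

theorem homogenize_diffMap_zero {R : Type*} [Ring R] (s : Fin (n + 1) → ℕ)
    (x : Fin (n + 1) → R) : homogenize s (diffMap x) (Fin.castSucc 0) = x 0 := by
  rw [homogenize_diffMap_castSucc, Fin.castSucc_zero, Fin.cons_zero, sub_zero]

theorem homogenize_diffMap_succ {R : Type*} [Ring R] (s : Fin (n + 1) → ℕ)
    (x : Fin (n + 1) → R) (i : Fin n) :
    homogenize s (diffMap x) i.succ.castSucc = x i.succ - x i.castSucc := by
  rw [homogenize_diffMap_castSucc, ← Fin.succ_castSucc, Fin.cons_succ]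

theorem sum_diffMap {R : Type*} [Ring R] (x : Fin (n + 1) → R) :
    ∑ i, diffMap x i = x (Fin.last n) := by
  have h1 : ∑ i, (Fin.cons 0 x : Fin (n + 2) → R) i = ∑ i, x i := by
    rw [Fin.sum_univ_succ]; simp
  rw [Fin.sum_univ_castSucc] at h1
  have h2 : (Fin.cons 0 x : Fin (n + 2) → R) (Fin.last (n + 1)) = x (Fin.last n) := by
    rw [← Fin.succ_last, Fin.cons_succ]
  rw [h2] at h1
  simp only [diffMap, Finset.sum_sub_distrib]
  rw [← h1]; abel

theorem homogenize_diffMap_last {R : Type*} [Ring R] (s : Fin (n + 1) → ℕ)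
    (x : Fin (n + 1) → R) :
    homogenize s (diffMap x) (Fin.last (n + 1)) =
      (s (Fin.last n) : R) + 1 - x (Fin.last n) := by
  rw [← sum_diffMap x]; simp [homogenize]

theorem cast_homogenize_diffMap (s : Fin (n + 1) → ℕ) (x : Fin (n + 1) → ℤ) (i : Fin (n + 2)) :
    ((homogenize s (diffMap x) i : ℤ) : ℝ) =
      homogenize s (diffMap fun j => (x j : ℝ)) i := by
  induction i using Fin.lastCases with
  | last => simp [homogenize_diffMap_last]
  | cast i =>
    cases i using Fin.cases with
    | zero => rw [homogenize_diffMap_zero, homogenize_diffMap_zero]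
    | succ i => rw [homogenize_diffMap_succ, homogenize_diffMap_succ, Int.cast_sub]

theorem homogenize_diffMap_injective {R : Type*} [Ring R] (s : Fin (n + 1) → ℕ) :
    Function.Injective (fun x : Fin (n + 1) → R => homogenize s (diffMap x)) := by
  intro x y hxy
  funext i
  induction i using Fin.induction with
  | zero =>
    have h := congrFun hxy (Fin.castSucc 0)
    dsimp only at h
    rwa [homogenize_diffMap_zero, homogenize_diffMap_zero] at h
  | succ i ih =>
    have h := congrFun hxy i.succ.castSucc
    dsimp only at h
    rw [homogenize_diffMap_succ, homogenize_diffMap_succ, ih] at h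
    exact sub_left_inj.mp h

theorem exists_int_of_diffMap (s : Fin (n + 1) → ℕ) (x : Fin (n + 1) → ℝ) (z : Fin (n + 2) → ℤ)
    (h : homogenize s (diffMap x) = fun i => (z i : ℝ)) (i : Fin (n + 1)) :
    ∃ k : ℤ, x i = k := by
  induction i using Fin.induction with
  | zero =>
    have h := congrFun h (Fin.castSucc 0)
    rw [homogenize_diffMap_zero] at h
    exact ⟨_, h⟩
  | succ i ih =>
    obtain ⟨k, hk⟩ := ih
    have h := congrFun h i.succ.castSucc
    rw [homogenize_diffMap_succ] at h
    exact ⟨z i.succ.castSucc + k, by push_cast; linarith⟩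

theorem nonneg_of_mem_latticePoints {s : Fin (n + 1) → ℕ} (hs : IsZeroOneSeq s)
    {z : Fin (n + 2) → ℤ} (hz : z ∈ latticePoints (simplexA s)) (i : Fin (n + 2)) : 0 ≤ z i := by
  obtain ⟨x, ⟨⟨h0, hx⟩, hl⟩, hxz⟩ := hz
  have hpos : ∀ i, (0 : ℝ) < s i := fun i => by exact_mod_cast hs.pos i
  have hnn : ∀ i, 0 ≤ x i := by
    intro i
    have : 0 ≤ x i / (s i : ℝ) := by
      induction i using Fin.induction with
      | zero => exact h0
      | succ i ih => exact ih.trans (hx i)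
    rwa [le_div_iff₀ (hpos i), zero_mul] at this
  have hz : ∀ i, (z i : ℝ) = homogenize s (diffMap x) i := fun i => (congrFun hxz i).symm
  have : (0 : ℝ) ≤ z i := by
    rw [hz]
    induction i using Fin.lastCases with
    | last => rw [homogenize_diffMap_last]; linarith
    | cast i =>
      cases i using Fin.cases with
      | zero => rw [homogenize_diffMap_zero]; exact hnn 0
      | succ i =>
        rw [homogenize_diffMap_succ, sub_nonneg]
        have h1 := hx i
        rw [div_le_div_iff₀ (hpos _) (hpos _)] at h1
        have h2 : (s i.castSucc : ℝ) ≤ s i.succ := by exact_mod_cast hs.le_succ i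
        have h3 : x i.castSucc * s i.castSucc ≤ x i.succ * s i.castSucc :=
          (mul_le_mul_of_nonneg_left h2 (hnn _)).trans h1
        exact le_of_mul_le_mul_right h3 (hpos _)
  exact_mod_cast this

/-- The labelling of the lattice points of `simplexA s` by the lecture hall multisets. -/
def labelA (s : Fin (n + 1) → ℕ) (hs : IsZeroOneSeq s) :
    LHMultiset s ≃ latticePoints (simplexA s) :=
  Equiv.ofBijective (fun I => ⟨mult I.1, I.2⟩) <| by
    constructor
    · intro I J h
      apply Subtype.ext
      ext i
      have h1 : mult I.1 = mult J.1 := congrArg Subtype.val h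
      exact Int.ofNat_inj.mp (congrFun h1 i)
    · rintro ⟨z, hz⟩
      have h : mult (∑ i, Multiset.replicate (z i).toNat i) = z := by
        funext i
        simp only [mult, Multiset.count_sum', Multiset.count_replicate]
        rw [Finset.sum_ite_eq' Finset.univ i]
        simp [nonneg_of_mem_latticePoints hs hz i]
      exact ⟨⟨_, h.symm ▸ hz⟩, Subtype.ext h⟩

/-- The bijection `homogenize ∘ diffMap` from the lattice points of `simplexP s` to those of
`simplexA s`. -/
def latticeEquiv (s : Fin (n + 1) → ℕ) :
    latticePoints (simplexP s) ≃ latticePoints (simplexA s) :=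
  Equiv.ofBijective
    (fun x => ⟨homogenize s (diffMap x.1),
      ⟨fun j => (x.1 j : ℝ), x.2, funext fun i => (cast_homogenize_diffMap s x.1 i).symm⟩⟩) <| by
    constructor
    · intro x y h
      exact Subtype.ext (homogenize_diffMap_injective s (congrArg Subtype.val h))
    · rintro ⟨z, x, hx, hxz⟩
      choose k hk using exists_int_of_diffMap s x z hxz
      have hkx : x = fun j => (k j : ℝ) := funext hk
      subst hkx
      refine ⟨⟨k, hx⟩, Subtype.ext (funext fun i => ?_)⟩
      have h := congrFun hxz i
      simp only [← cast_homogenize_diffMap] at h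
      exact_mod_cast h

/-- The labelling of the lattice points of `simplexP s` by the lecture hall multisets. -/
def labelP (s : Fin (n + 1) → ℕ) (hs : IsZeroOneSeq s) :
    LHMultiset s ≃ latticePoints (simplexP s) :=
  (labelA s hs).trans (latticeEquiv s).symm

/-! Collections of lecture hall multisets, with repetitions allowed. -/

/-- The multiplicity vectors of the members of a collection, in lexicographically decreasing
order. -/
def sortedVectors {s : Fin (n + 1) → ℕ} (C : Multiset (LHMultiset s)) :
    List (Lex (Fin (n + 2) → ℤ)) :=
  (C.map fun I => toLex (mult I.1)).sort (· ≥ ·)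

/-- The multiunion of the members of a collection. -/
def multiunion {s : Fin (n + 1) → ℕ} (C : Multiset (LHMultiset s)) : Multiset (Fin (n + 2)) :=
  (C.map Subtype.val).sum

/-- `C` is lexicographically smaller than every other collection of as many lecture hall multisets
with the same multiunion. -/
def IsMinimalCollection {s : Fin (n + 1) → ℕ} (C : Multiset (LHMultiset s)) : Prop :=
  ∀ D : Multiset (LHMultiset s), D.card = C.card → multiunion D = multiunion C → D ≠ C →
    sortedVectors C < sortedVectors D

theorem sortedVectors_injective (s : Fin (n + 1) → ℕ) :
    Function.Injective (sortedVectors (s := s)) := by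
  intro C D h
  have h1 := congrArg (fun l : List (Lex (Fin (n + 2) → ℤ)) => (l : Multiset (Lex (Fin (n + 2) → ℤ)))) h
  simp only [sortedVectors, Multiset.sort_eq] at h1
  refine Multiset.map_injective (fun I J hIJ => Subtype.ext (Multiset.ext.mpr fun i => ?_)) h1
  have h2 : mult I.1 = mult J.1 := toLex.injective hIJ
  exact Int.ofNat_inj.mp (congrFun h2 i)

theorem finite_collections {s : Fin (n + 1) → ℕ} (C : Multiset (LHMultiset s)) :
    {D : Multiset (LHMultiset s) | D.card = C.card ∧ multiunion D = multiunion C}.Finite := by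
  have hfin : {I : LHMultiset s | I.1 ≤ multiunion C}.Finite :=
    (Set.finite_Iic (multiunion C)).preimage Subtype.val_injective.injOn
  refine (Set.finite_Iic (C.card • hfin.toFinset.val)).subset ?_
  rintro D ⟨hc, hu⟩
  classical
  rw [Set.mem_Iic, Multiset.le_iff_count]
  intro I
  rw [Multiset.count_nsmul]
  by_cases hI : I ∈ D
  · have hle : I.1 ≤ multiunion C := by
      rw [← hu]
      exact Multiset.le_sum_of_mem (Multiset.mem_map_of_mem _ hI)
    have hmem : I ∈ hfin.toFinset.val := by simpa using hle
    rw [Multiset.count_eq_one_of_mem hfin.toFinset.nodup hmem, mul_one, ← hc]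
    exact Multiset.count_le_card I D
  · simp [Multiset.count_eq_zero_of_notMem hI]

theorem exists_isMinimalCollection {s : Fin (n + 1) → ℕ} (C : Multiset (LHMultiset s)) :
    ∃ D : Multiset (LHMultiset s),
      D.card = C.card ∧ multiunion D = multiunion C ∧ IsMinimalCollection D := by
  obtain ⟨D, hD, hmin⟩ := Set.exists_min_image _ sortedVectors (finite_collections C) ⟨C, rfl, rfl⟩
  refine ⟨D, hD.1, hD.2, fun E hc hu hne => ?_⟩
  exact lt_of_le_of_ne (hmin E ⟨hc.trans hD.1, hu.trans hD.2⟩)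
    fun h => hne (sortedVectors_injective s h).symm

/-- The minimal collection `{I_1⁻, …, I_k⁻}` with the same size and multiunion as
`C = {I_1, …, I_k}`; it is unique by the definition of minimality. -/
def minimalCollection {s : Fin (n + 1) → ℕ} (C : Multiset (LHMultiset s)) :
    Multiset (LHMultiset s) :=
  (exists_isMinimalCollection C).choose

theorem minimalCollection_spec {s : Fin (n + 1) → ℕ} (C : Multiset (LHMultiset s)) :
    (minimalCollection C).card = C.card ∧ multiunion (minimalCollection C) = multiunion C ∧
      IsMinimalCollection (minimalCollection C) :=
  (exists_isMinimalCollection C).choose_spec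

/-- The monomial `x_{I_1} ⋯ x_{I_k}` of a collection `{I_1, …, I_k}`. -/
def collectionMonomial (K : Type*) [Field K] {s : Fin (n + 1) → ℕ}
    (C : Multiset (LHMultiset s)) : MvPolynomial (LHMultiset s) K :=
  (C.map X).prod

/-- The binomials `x_I x_J - x_{I⁻} x_{J⁻}`; the pairs with `{I, J} = {I⁻, J⁻}`, whose binomial
is zero, are left out. -/
def binomials (K : Type*) [Field K] (s : Fin (n + 1) → ℕ) :
    Set (MvPolynomial (LHMultiset s) K) :=
  {f | ∃ I J : LHMultiset s, minimalCollection {I, J} ≠ {I, J} ∧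
    f = collectionMonomial K {I, J} - collectionMonomial K (minimalCollection {I, J})}

end LectureHall

end

/-! A lattice point of `simplexA s` is a vector of naturals with sum `s_last + 1`. If the sequence
stays constant at a step, the lecture hall inequality there only says that the new coordinate is
nonnegative. If it ascends, the inequality says that the new coordinate is positive as soon as an
earlier one is, because partial sums are bounded by the sequence. So the polytope is encoded by a
set `T` of positions, the ascent tops together with the last one, through `Admissible`; the two
directions are `admissible_of_mem` and `Admissible.mem`.

Take a pair `f > g` of admissible vectors. If `f` has a spare unit at `i` and `g` a spare unit at
some `j > i`, exchanging them makes both vectors smaller than `f`, hence the pair smaller.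
`exists_shift` shows that such an exchange exists unless the pair is balanced, so minimal pairs are
balanced. The combinatorial core is `eq_of_balanced`: a sorted, pairwise balanced family is
determined by its size and its sum. Hence a collection all of whose pairs are minimal is unique in
its fibre (`eq_of_pairwise_minimal`).

For the term order take lex, with larger variables for larger multiplicity vectors. Both members of
the minimal replacement of a non-minimal pair lie strictly below the larger member of the pair, so
the underlined term leads. The leading monomial of an element of the toric ideal shares its fibre
with a smaller monomial. If it contained no non-minimal pair, uniqueness would make it the least
monomial of the fibre, a contradiction; so it is divisible by an underlined monomial. -/

namespace LectureHall

/-! ### Admissible functions and exchanges between them. -/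

/-- The lexicographic order on functions, in the form in which it is used below. -/
def LexLE {α : Type*} [LT α] (g f : α → ℕ) : Prop :=
  ∀ i, (∀ j < i, g j = f j) → g i ≤ f i

/-- The functions with sum `r` whose support contains every element of `T` that is not below
the support. -/
structure Admissible {α : Type*} [LE α] [Fintype α] (T : Finset α) (r : ℕ) (f : α → ℕ) : Prop where
  sum_eq : ∑ i, f i = r
  pos : ∀ t ∈ T, ∀ i ≤ t, 0 < f i → 0 < f t

/-- The shape of a pair `f > g` of admissible functions that cannot be balanced any further. -/
def IsBalanced {α : Type*} [LinearOrder α] (T : Finset α) (f g : α → ℕ) : Prop :=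
  ∃ p, f p = g p + 1 ∧ ((∀ j < p, f j = g j) ∨ (p ∈ T ∧ ∀ j ≤ p, g j = 0)) ∧
    ∀ i, p < i → (f i ≤ if i ∈ T then 1 else 0) ∨ ∀ j, i < j → g j ≤ if j ∈ T then 1 else 0

section

variable {α : Type*} [LinearOrder α] [Fintype α] {T : Finset α} {r : ℕ} {f g : α → ℕ}

theorem Admissible.indicator_le (hf : Admissible T r f) {i j : α} (hij : i ≤ j) (hi : 0 < f i) :
    (if j ∈ T then 1 else 0) ≤ f j := by
  split_ifs with h
  · exact hf.pos j h i hij hi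
  · exact Nat.zero_le _

theorem LexLE.eq_zero {i : α} (h : LexLE g f) (hf : ∀ j ≤ i, f j = 0) : ∀ j ≤ i, g j = 0 := by
  intro j
  induction j using WellFoundedLT.induction with
  | ind j ih =>
    intro hj
    have := h j fun l hl => (ih l hl (hl.le.trans hj)).trans (hf l (hl.le.trans hj)).symm
    have := hf j hj
    omega

theorem LexLE.exists_pos {i j : α} (h : LexLE g f) (hj : j ≤ i) (hg : 0 < g j) :
    ∃ l ≤ i, 0 < f l := by
  by_contra! hc
  have := h.eq_zero (i := i) (fun l hl => Nat.le_zero.mp (hc l hl)) j hj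
  omega

theorem exists_first_difference (h : f ≠ g) : ∃ p, f p ≠ g p ∧ ∀ j < p, f j = g j := by
  obtain ⟨i, hi⟩ := Function.ne_iff.mp h
  obtain ⟨p, hp, hmin⟩ := WellFounded.has_min (wellFounded_lt (α := α)) {i | f i ≠ g i} ⟨i, hi⟩
  exact ⟨p, hp, fun j hj => by_contra fun hc => hmin j hc hj⟩

/-- Moving a unit of `f` from `i` to `j`. -/
def shift {α : Type*} [DecidableEq α] (f : α → ℕ) (i j : α) : α → ℕ :=
  fun l => (f l - if l = i then 1 else 0) + if l = j then 1 else 0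

theorem sum_shift {i j : α} (hi : 0 < f i) : ∑ l, shift f i j l = ∑ l, f l := by
  have h : ∀ l, (if l = i then 1 else 0) ≤ f l := by
    intro l; split_ifs with h
    · subst h; exact hi
    · exact Nat.zero_le _
  have h1 : ∑ l, (f l - if l = i then 1 else 0) + ∑ l, (if l = i then 1 else 0) = ∑ l, f l := by
    rw [← Finset.sum_add_distrib]
    exact Finset.sum_congr rfl fun l _ => Nat.sub_add_cancel (h l)
  simp only [shift, Finset.sum_add_distrib]
  rw [← h1]
  simp

/-- A pair `f > g` of admissible functions that is not balanced can be improved by an exchange. -/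
theorem exists_shift (hf : Admissible T r f) (hg : Admissible T r g) (hgf : LexLE g f)
    (hne : f ≠ g) (hb : ¬ IsBalanced T f g) :
    ∃ i j, i < j ∧ 0 < f i ∧ 0 < g j ∧ Admissible T r (shift f i j) ∧
      Admissible T r (shift g j i) ∧
      ∃ q ≤ i, (∀ l < q, shift g j i l = f l) ∧ shift g j i q < f q := by
  obtain ⟨q, hq, hqeq⟩ := exists_first_difference hne
  have hqlt : g q < f q := lt_of_le_of_ne (hgf q fun j hj => (hqeq j hj).symm) hq.symm
  -- the position after which `f` and `g` can be compared freely
  obtain ⟨p, hqp, hp, hp', hpmax⟩ : ∃ p, q ≤ p ∧ g p < f p ∧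
      ((p = q ∧ ∀ j < p, f j = g j) ∨ (f p = g p + 1 ∧ p ∈ T ∧ ∀ j ≤ p, g j = 0)) ∧
      ∀ t ∈ T, p < t → (∀ j ≤ t, g j = 0) → f t ≠ 1 := by
    -- If `f` is 1 at a position of `T` up to which `g` vanishes, take the last such position. A
    -- unit of `g` moved below it would force `g` to be positive there. Otherwise the first
    -- difference serves.
    by_cases hS : (T.filter fun t => f t = 1 ∧ ∀ j ≤ t, g j = 0).Nonempty
    · have hm := Finset.max'_mem _ hS
      set p := Finset.max' _ hS with hpdef
      simp only [Finset.mem_filter] at hm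
      obtain ⟨h1, h2, h3⟩ := hm
      have h4 := h3 p le_rfl
      refine ⟨p, ?_, by omega, Or.inr ⟨by omega, h1, h3⟩, ?_⟩
      · by_contra! hc
        have := hqeq p hc
        omega
      · intro t ht hpt h0 hc
        have h5 : t ∈ T.filter fun t => f t = 1 ∧ ∀ j ≤ t, g j = 0 :=
          Finset.mem_filter.mpr ⟨ht, hc, h0⟩
        exact absurd (Finset.le_max' _ t h5) (not_le.mpr hpt)
    · refine ⟨q, le_rfl, hqlt, Or.inl ⟨rfl, hqeq⟩, fun t ht _ h0 hc => hS ⟨t, ?_⟩⟩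
      exact Finset.mem_filter.mpr ⟨ht, hc, h0⟩
  have hfpos : ∀ i, p ≤ i → (if i ∈ T then 1 else 0) ≤ f i := fun i hi =>
    hf.indicator_le hi (by omega)
  -- `f` has a unit to spare at `i`, and `g` has one to spare further right. At `p` a surplus of two
  -- over `g` is required, so that `f` still dominates after the exchange.
  let bad : α → Prop := fun i => ((p < i ∧ (if i ∈ T then 1 else 0) < f i) ∨ (i = p ∧ g p + 1 < f p)) ∧
    ∃ j, i < j ∧ (if j ∈ T then 1 else 0) < g j
  have hbad : ∃ i, bad i := by
    by_contra! hc
    refine hb ⟨p, ?_, ?_, ?_⟩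
    · by_contra hne'
      have h1 : ∀ j, p < j → g j ≤ f j := by
        intro j hj
        refine le_trans ?_ (hfpos j hj.le)
        by_contra! h2
        exact hc p ⟨Or.inr ⟨rfl, by omega⟩, j, hj, h2⟩
      -- In the tie case `g` would be at most `f` everywhere and smaller at `p`, against the equal
      -- sums.
      rcases hp' with ⟨-, h2⟩ | ⟨h2, -⟩
      · have : ∑ i, g i < ∑ i, f i := by
          refine Finset.sum_lt_sum (fun i _ => ?_) ⟨p, Finset.mem_univ _, hp⟩
          rcases lt_trichotomy i p with h | h | h
          · exact (h2 i h).ge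
          · rw [h]; exact hp.le
          · exact h1 i h
        rw [hf.sum_eq, hg.sum_eq] at this
        exact lt_irrefl _ this
      · exact hne' h2
    · exact hp'.imp (fun h => h.2) fun h => h.2
    · intro i hi
      by_contra! h2
      exact hc i ⟨Or.inl ⟨hi, h2.1⟩, h2.2⟩
  classical
  have hS : (Finset.univ.filter bad).Nonempty := by
    obtain ⟨i, hi⟩ := hbad
    exact ⟨i, Finset.mem_filter.mpr ⟨Finset.mem_univ _, hi⟩⟩
  have him := (Finset.mem_filter.mp (Finset.max'_mem _ hS)).2
  have hmax : ∀ i', bad i' → i' ≤ Finset.max' _ hS := fun i' h' =>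
    Finset.le_max' _ i' (Finset.mem_filter.mpr ⟨Finset.mem_univ _, h'⟩)
  -- Taking the last bad index is what keeps the modified `g` admissible.
  set i := Finset.max' _ hS with hi_def
  obtain ⟨hi, j, hij, hj⟩ := him
  have hpi : p ≤ i := by
    rcases hi with h | h
    · exact h.1.le
    · exact h.1.ge
  have hfi : (if i ∈ T then 1 else 0) < f i := by
    rcases hi with h | h
    · exact h.2
    · rw [h.1]; split_ifs <;> omega
  have hfi' : 0 < f i := by omega
  have hgj' : 0 < g j := by omega
  refine ⟨i, j, hij, hfi', hgj', ⟨by rw [sum_shift hfi', hf.sum_eq], ?_⟩,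
    ⟨by rw [sum_shift hgj', hg.sum_eq], ?_⟩, q, hqp.trans hpi, ?_, ?_⟩
  · intro t ht l hl hl0
    have h1 : 0 < f t := by
      by_cases h : 0 < f l
      · exact hf.pos t ht l hl h
      · have : l = j := by
          by_contra hne'
          simp [shift, hne'] at hl0
          omega
        exact hf.pos t ht i (hij.le.trans (this ▸ hl)) hfi'
    simp only [shift]
    by_cases h : t = i
    · subst h
      simp only [ht, if_true] at hfi ⊢
      omega
    · simp [h, h1]
  · intro t ht l hl hl0
    simp only [shift]
    -- The only danger is a `t ∈ T` beyond `i` up to which `g` vanishes. There `f t` is positive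
    -- and, by the choice of `p`, not 1; so `t` would be a later bad index with the same `j`.
    by_cases h : ∀ l ≤ t, g l = 0
    · have hli : l = i := by
        by_contra hne'
        simp [shift, hne'] at hl0
        have := h l hl
        omega
      rcases (hli ▸ hl).eq_or_lt with h2 | h2
      · simp [h2]
      · exfalso
        refine absurd (hmax t ⟨Or.inl ⟨hpi.trans_lt h2, ?_⟩, j, ?_, hj⟩) (not_le.mpr h2)
        · have h3 := hfpos t (hpi.trans h2.le)
          have h4 := hpmax t ht (hpi.trans_lt h2) h
          simp only [ht, if_true] at h3 ⊢
          omega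
        · by_contra! h3
          have := h j h3
          omega
    · push Not at h
      obtain ⟨l', hl', h'⟩ := h
      have h1 := hg.pos t ht l' hl' (by omega)
      by_cases h2 : t = j
      · subst h2
        simp only [ht, if_true] at hj ⊢
        omega
      · simp [h2, h1]
  · intro l hl
    have h1 : l ≠ i := (hl.trans_le (hqp.trans hpi)).ne
    have h2 : l ≠ j := ((hl.trans_le (hqp.trans hpi)).trans hij).ne
    simp [shift, h1, h2, hqeq l hl]
  · have h2 : q ≠ j := ((hqp.trans hpi).trans_lt hij).ne
    by_cases h1 : q = i
    · have h3 : i = p := le_antisymm (h1 ▸ hqp) hpi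
      rcases hi with h | h
      · exact absurd h3 h.1.ne'
      · simp only [shift, h1, if_true]
        rw [h3]
        omega
    · simpa [shift, h1, h2] using hqlt

/-! ### Uniqueness of sorted, pairwise balanced families. -/

variable {k : ℕ} {C D : Fin k → α → ℕ}

/-- If `C` and `D` agree before `i` and differ at `i` at `a < b`, then `a` and `b` are
separated in `C` by an element of `T` above `i`. -/
theorem exists_separator (hC : ∀ a, Admissible T r (C a))
    (hD : ∀ a, Admissible T r (D a)) (hDs : ∀ a b, a ≤ b → LexLE (D b) (D a))
    (hCb : ∀ a b, a ≤ b → C a ≠ C b → IsBalanced T (C a) (C b))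
    {i : α} (hi : ∀ j < i, ∀ a, C a j = D a j) {a b : Fin k} (hab : a < b)
    (ha : D a i < C a i) (hb : C b i < D b i) :
    ∃ p ∈ T, i < p ∧ C a p = 1 ∧ ∀ j ≤ p, C b j = 0 := by
  have htie : (∀ j < i, C a j = C b j) → D b i ≤ D a i := fun h =>
    hDs a b hab.le i fun j hj => by rw [← hi j hj, ← hi j hj, h j hj]
  have hne : C a ≠ C b := by
    intro h
    have := htie fun j _ => congrFun h j
    have := congrFun h i
    omega
  obtain ⟨p, hp, hp', hlate⟩ := hCb a b hab.le hne
  -- If the balancing position `p` is before `i`, then past `p` either `C a` is already as small as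
  -- admissibility allows at `i`, or `C b` is so after `i` and its sum is too small. At `p = i`, the
  -- order of `D` is violated. After `i`, a tie is impossible, which leaves the separator.
  rcases lt_trichotomy p i with h | h | h
  · exfalso
    rcases hlate i h with h1 | h1
    · have h2 : 0 < D a p := by rw [← hi p h]; omega
      have := (hD a).indicator_le h.le h2
      omega
    · have : ∑ l, C b l < ∑ l, D b l := by
        refine Finset.sum_lt_sum (fun l _ => ?_) ⟨i, Finset.mem_univ _, hb⟩
        rcases lt_trichotomy l i with h2 | h2 | h2
        · rw [hi l h2]
        · rw [h2]; exact hb.le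
        · exact (h1 l h2).trans ((hD b).indicator_le h2.le (by omega))
      rw [(hC b).sum_eq, (hD b).sum_eq] at this
      exact lt_irrefl _ this
  · exfalso
    subst h
    rcases hp' with h1 | ⟨h1, h2⟩
    · have := htie h1
      omega
    · have h3 : ∀ j ≤ p, D a j = 0 := by
        intro j hj
        by_contra hc
        have := (hD a).pos p h1 j hj (by omega)
        have := h2 p le_rfl
        omega
      have := (hDs a b hab.le).eq_zero h3 p le_rfl
      omega
  · rcases hp' with h1 | ⟨h1, h2⟩
    · have := htie fun j hj => h1 j (hj.trans h)
      have := h1 i h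
      omega
    · exact ⟨p, h1, h, by rw [hp, h2 p le_rfl], h2⟩

/-- A separator `q` yields a column in which `C` sums to less than `D`. Let `c` be the first index
at which `C` vanishes up to `i`, and `q` the last separator for `c`. Then column `q` of `C` is 1
before `c` and 0 from `c` on, while admissibility makes column `q` of `D` positive through `c`. -/
theorem not_exchanged (hT : T.card < r) (hC : ∀ a, Admissible T r (C a))
    (hD : ∀ a, Admissible T r (D a)) (hCs : ∀ a b, a ≤ b → LexLE (C b) (C a))
    (hDs : ∀ a b, a ≤ b → LexLE (D b) (D a))
    (hCb : ∀ a b, a ≤ b → C a ≠ C b → IsBalanced T (C a) (C b))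
    (hsum : ∀ i, ∑ a, C a i = ∑ a, D a i)
    {i : α} (hi : ∀ j < i, ∀ a, C a j = D a j) {a b : Fin k} (hab : a < b)
    (ha : D a i < C a i) (hb : C b i < D b i) : False := by
  classical
  obtain ⟨p, -, hip, -, hp0⟩ := exists_separator hC hD hDs hCb hi hab ha hb
  -- replace `b` by the first index at which `C` vanishes up to `i`
  obtain ⟨c, hc0, hcmin⟩ : ∃ c, (∀ j ≤ i, C c j = 0) ∧ ∀ d < c, ∃ j ≤ i, 0 < C d j := by
    obtain ⟨c, hc, hmin⟩ := WellFounded.has_min (wellFounded_lt (α := Fin k))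
      {c | ∀ j ≤ i, C c j = 0} ⟨b, fun j hj => hp0 j (hj.trans hip.le)⟩
    refine ⟨c, hc, fun d hd => ?_⟩
    by_contra! h
    exact hmin d (fun j hj => Nat.le_zero.mp (h j hj)) hd
  have hcb : c ≤ b := by
    by_contra! h
    obtain ⟨j, hj, h'⟩ := hcmin b h
    have := hp0 j (hj.trans hip.le)
    omega
  have hac : a < c := by
    by_contra! h
    have := (hCs c a h).eq_zero hc0 i le_rfl
    omega
  have hDpos : ∀ d ≤ c, ∃ j ≤ i, 0 < D d j := fun d hd =>
    (hDs d b (hd.trans hcb)).exists_pos le_rfl (by omega)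
  have hDc : C c i < D c i := by
    obtain ⟨j, hj, h⟩ := hDpos c le_rfl
    rcases hj.eq_or_lt with rfl | h'
    · rwa [hc0 j le_rfl]
    · rw [← hi j h', hc0 j hj] at h
      exact absurd h (lt_irrefl _)
  obtain ⟨p, hpT, hip, hap, hp0⟩ := exists_separator hC hD hDs hCb hi hac ha hDc
  have hS : (T.filter fun p => (i < p ∧ ∀ j ≤ p, C c j = 0) ∧ ∃ d < c, C d p = 1).Nonempty :=
    ⟨p, Finset.mem_filter.mpr ⟨hpT, ⟨hip, hp0⟩, a, hac, hap⟩⟩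
  obtain ⟨hqT, ⟨hiq, hq0⟩, -⟩ := Finset.mem_filter.mp (Finset.max'_mem _ hS)
  have hmax : ∀ l ∈ T.filter fun p => (i < p ∧ ∀ j ≤ p, C c j = 0) ∧ ∃ d < c, C d p = 1,
      l ≤ Finset.max' _ hS := fun l hl => Finset.le_max' _ l hl
  set q := Finset.max' _ hS with hq
  have hC1 : ∀ d < c, C d q = 1 := by
    intro d hd
    obtain ⟨j, hj, hdj⟩ := hcmin d hd
    have hne : C d ≠ C c := by
      intro h
      have := congrFun h j
      have := hc0 j hj
      omega
    obtain ⟨l, hl, hl', hlate⟩ := hCb d c hd.le hne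
    rcases lt_trichotomy l q with h | h | h
    · rcases hlate q h with h1 | h1
      · have := (hC d).pos q hqT j (hj.trans hiq.le) hdj
        simp only [hqT, if_true] at h1
        omega
      -- Here `C c` would be supported in `T` with values at most 1, so its sum would be at most
      -- `T.card < r`.
      · exfalso
        have h2 : ∑ l, C c l ≤ ∑ l, if l ∈ T then 1 else 0 := by
          refine Finset.sum_le_sum fun l _ => ?_
          rcases le_or_gt l q with h3 | h3
          · rw [hq0 l h3]; exact Nat.zero_le _
          · exact h1 l h3
        rw [(hC c).sum_eq] at h2
        simp at h2
        omega
    · rw [← h, hl, h, hq0 q le_rfl]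
    · exfalso
      rcases hl' with h1 | ⟨h1, h2⟩
      · have := h1 j (hj.trans_lt (hiq.trans h))
        have := hc0 j hj
        omega
      · have := hmax l (Finset.mem_filter.mpr ⟨h1, ⟨hiq.trans h, h2⟩, d, hd, by
          rw [hl, h2 l le_rfl]⟩)
        exact absurd this (not_le.mpr h)
  have h1 : ∀ d, C d q ≤ D d q := by
    intro d
    rcases lt_or_ge d c with h | h
    · rw [hC1 d h]
      obtain ⟨j, hj, h'⟩ := hDpos d h.le
      exact (hD d).pos q hqT j (hj.trans hiq.le) h'
    · rw [(hCs c d h).eq_zero hq0 q le_rfl]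
      exact Nat.zero_le _
  have h2 : C c q < D c q := by
    rw [hq0 q le_rfl]
    exact (hD c).pos q hqT i hiq.le (by omega)
  have := Finset.sum_lt_sum (fun d _ => h1 d) ⟨c, Finset.mem_univ _, h2⟩
  exact absurd (hsum q) this.ne

/-- Two pairwise balanced, sorted families with the same sum coincide. -/
theorem eq_of_balanced (hT : T.card < r) (hC : ∀ a, Admissible T r (C a))
    (hD : ∀ a, Admissible T r (D a)) (hCs : ∀ a b, a ≤ b → LexLE (C b) (C a))
    (hDs : ∀ a b, a ≤ b → LexLE (D b) (D a))
    (hCb : ∀ a b, a ≤ b → C a ≠ C b → IsBalanced T (C a) (C b))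
    (hDb : ∀ a b, a ≤ b → D a ≠ D b → IsBalanced T (D a) (D b))
    (hsum : ∀ i, ∑ a, C a i = ∑ a, D a i) : C = D := by
  suffices h : ∀ i, ∀ a, C a i = D a i from funext fun a => funext fun i => h i a
  intro i
  induction i using WellFoundedLT.induction with
  | ind i ih =>
    by_contra! hne
    obtain ⟨a, ha⟩ := hne
    obtain ⟨⟨a, ha⟩, b, hb⟩ : (∃ a, D a i < C a i) ∧ ∃ b, C b i < D b i := by
      constructor
      · by_contra! h
        have := Finset.sum_lt_sum (fun d _ => h d)
          ⟨a, Finset.mem_univ _, lt_of_le_of_ne (h a) ha⟩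
        exact absurd (hsum i) this.ne
      · by_contra! h
        have := Finset.sum_lt_sum (fun d _ => h d)
          ⟨a, Finset.mem_univ _, lt_of_le_of_ne (h a) (Ne.symm ha)⟩
        exact absurd (hsum i) this.ne'
    rcases lt_trichotomy a b with h | h | h
    · exact not_exchanged hT hC hD hCs hDs hCb hsum ih h ha hb
    · subst h; omega
    · exact not_exchanged hT hD hC hDs hCs hDb (fun i => (hsum i).symm)
        (fun j hj a => (ih j hj a).symm) h hb ha

end

/-! ### Lattice points of the simplex as admissible functions. -/

section

variable {n : ℕ}

open Classical in
/-- The positions at which the sequence `s_0, …, s_n, s_n + 1` increases. -/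
noncomputable def ascentTops (s : Fin (n + 1) → ℕ) : Finset (Fin (n + 2)) :=
  Finset.univ.filter fun j => j = Fin.last (n + 1) ∨
    ∃ i : Fin n, j = i.succ.castSucc ∧ s i.succ = s i.castSucc + 1

theorem mem_ascentTops {s : Fin (n + 1) → ℕ} {j : Fin (n + 2)} : j ∈ ascentTops s ↔
    j = Fin.last (n + 1) ∨ ∃ i : Fin n, j = i.succ.castSucc ∧ s i.succ = s i.castSucc + 1 := by
  simp [ascentTops]

theorem succ_castSucc_mem_ascentTops {s : Fin (n + 1) → ℕ} {i : Fin n} :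
    i.succ.castSucc ∈ ascentTops s ↔ s i.succ = s i.castSucc + 1 := by
  rw [mem_ascentTops]
  constructor
  · rintro (h | ⟨j, h, h'⟩)
    · exact absurd h (Fin.castSucc_ne_last _)
    · rw [Fin.castSucc_inj, Fin.succ_inj] at h
      rwa [h]
  · exact fun h => Or.inr ⟨i, rfl, h⟩

/-- Every ascent raises the sequence by exactly one, and the last position counts as the ascent to
`s_last + 1`. -/
theorem card_ascentTops_add {s : Fin (n + 1) → ℕ} (hs : IsZeroOneSeq s) (i : Fin (n + 1)) :
    ((ascentTops s).filter (i.castSucc < ·)).card + s i = s (Fin.last n) + 1 := by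
  induction i using Fin.reverseInduction with
  | last =>
    have : (ascentTops s).filter ((Fin.last n).castSucc < ·) = {Fin.last (n + 1)} := by
      ext j
      simp only [Finset.mem_filter, Finset.mem_singleton]
      constructor
      · rintro ⟨-, h⟩
        rw [Fin.ext_iff]
        have := j.isLt
        simp [Fin.lt_def] at h ⊢
        omega
      · rintro rfl
        exact ⟨mem_ascentTops.mpr (Or.inl rfl), Fin.castSucc_lt_last _⟩
    rw [this, Finset.card_singleton, add_comm]
  | cast i ih =>
    have hlt : ∀ j : Fin (n + 2), i.castSucc.castSucc < j ↔
        j = i.succ.castSucc ∨ i.succ.castSucc < j := by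
      intro j
      simp only [Fin.lt_def, Fin.ext_iff, Fin.val_castSucc, Fin.val_succ]
      omega
    by_cases h : s i.succ = s i.castSucc + 1
    · have h1 : (ascentTops s).filter (i.castSucc.castSucc < ·) =
          insert i.succ.castSucc ((ascentTops s).filter (i.succ.castSucc < ·)) := by
        ext j
        simp only [Finset.mem_filter, Finset.mem_insert, hlt]
        constructor
        · tauto
        · rintro (rfl | h')
          · exact ⟨succ_castSucc_mem_ascentTops.mpr h, Or.inl rfl⟩
          · tauto
      rw [h1, Finset.card_insert_of_notMem (by simp)]
      omega
    · have h1 : (ascentTops s).filter (i.castSucc.castSucc < ·) =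
          (ascentTops s).filter (i.succ.castSucc < ·) := by
        ext j
        simp only [Finset.mem_filter, hlt]
        constructor
        · rintro ⟨h1, rfl | h2⟩
          · exact absurd (succ_castSucc_mem_ascentTops.mp h1) h
          · exact ⟨h1, h2⟩
        · tauto
      have := hs.le_succ i
      have := hs.succ_le i
      rw [h1]
      omega

theorem card_ascentTops_lt {s : Fin (n + 1) → ℕ} (hs : IsZeroOneSeq s) :
    (ascentTops s).card < s (Fin.last n) + 1 := by
  have h := card_ascentTops_add hs 0
  have h1 : (ascentTops s).filter (Fin.castSucc 0 < ·) = ascentTops s := by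
    rw [Finset.filter_eq_self]
    intro j hj
    rcases mem_ascentTops.mp hj with rfl | ⟨i, rfl, -⟩
    · exact Fin.castSucc_lt_last _
    · simp [Fin.lt_def]
  rw [h1] at h
  have := hs.pos 0
  omega

/-- A nonzero prefix forces at least one unit at each ascent top after `i`, and these use up all but
`s i` of the total. -/
theorem Admissible.sum_Iic_le {s : Fin (n + 1) → ℕ} (hs : IsZeroOneSeq s) {f : Fin (n + 2) → ℕ}
    (hf : Admissible (ascentTops s) (s (Fin.last n) + 1) f) (i : Fin (n + 1)) :
    ∑ j ∈ Finset.Iic i.castSucc, f j ≤ s i := by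
  by_cases h : ∀ j ≤ i.castSucc, f j = 0
  · rw [Finset.sum_eq_zero fun j hj => h j (Finset.mem_Iic.mp hj)]
    exact Nat.zero_le _
  · push Not at h
    obtain ⟨j, hj, hj'⟩ := h
    have h1 : ((ascentTops s).filter (i.castSucc < ·)).card ≤
        ∑ l ∈ (ascentTops s).filter (i.castSucc < ·), f l := by
      rw [Finset.card_eq_sum_ones]
      refine Finset.sum_le_sum fun l hl => ?_
      obtain ⟨hl, hl'⟩ := Finset.mem_filter.mp hl
      exact hf.pos l hl j (hj.trans hl'.le) (Nat.pos_of_ne_zero hj')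
    have h2 : Disjoint (Finset.Iic i.castSucc) ((ascentTops s).filter (i.castSucc < ·)) := by
      rw [Finset.disjoint_left]
      intro l hl hl'
      exact absurd (Finset.mem_Iic.mp hl) (not_le.mpr (Finset.mem_filter.mp hl').2)
    have h3 : ∑ l ∈ Finset.Iic i.castSucc ∪ (ascentTops s).filter (i.castSucc < ·), f l ≤
        ∑ l, f l := Finset.sum_le_sum_of_subset (Finset.subset_univ _)
    rw [Finset.sum_union h2, hf.sum_eq] at h3
    have := card_ascentTops_add hs i
    omega

theorem admissible_of_mem {s : Fin (n + 1) → ℕ} (hs : IsZeroOneSeq s) {f : Fin (n + 2) → ℕ}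
    (hf : (fun i => (f i : ℤ)) ∈ latticePoints (simplexA s)) :
    Admissible (ascentTops s) (s (Fin.last n) + 1) f := by
  obtain ⟨x, ⟨⟨h0, hx⟩, hl⟩, hxf⟩ := hf
  have hz : ∀ i, homogenize s (diffMap x) i = f i := fun i => by
    simpa using congrFun hxf i
  have hlast := hz (Fin.last (n + 1))
  rw [homogenize_diffMap_last] at hlast
  have hzero := hz (Fin.castSucc 0)
  rw [homogenize_diffMap_zero] at hzero
  have hstep : ∀ i : Fin n, x i.succ - x i.castSucc = f i.succ.castSucc := fun i => by
    rw [← hz, homogenize_diffMap_succ]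
  have hpos : ∀ i, (0 : ℝ) < s i := fun i => by exact_mod_cast hs.pos i
  have hle : ∀ i : Fin (n + 1), ∀ j ≤ i.castSucc, (f j : ℝ) ≤ x i := by
    intro i
    induction i using Fin.induction with
    | zero =>
      intro j hj
      have : j = Fin.castSucc 0 := le_antisymm hj (Fin.zero_le j)
      rw [this, hzero]
    | succ i ih =>
      intro j hj
      have h1 := hstep i
      have h2 : (0 : ℝ) ≤ f i.succ.castSucc := Nat.cast_nonneg _
      rcases hj.eq_or_lt with rfl | h
      · have := (Nat.cast_nonneg (f 0) : (0 : ℝ) ≤ _).trans (ih 0 (Fin.zero_le _))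
        linarith
      · have := ih j (by
          simp only [Fin.lt_def, Fin.le_def, Fin.val_castSucc, Fin.val_succ] at h ⊢
          omega)
        linarith
  constructor
  · have h : (∑ i, (f i : ℝ)) = s (Fin.last n) + 1 := by
      rw [Fin.sum_univ_castSucc, ← hlast]
      have : ∑ i : Fin (n + 1), (f i.castSucc : ℝ) = x (Fin.last n) := by
        rw [← sum_diffMap x]
        refine Finset.sum_congr rfl fun i _ => ?_
        rw [← hz, homogenize_diffMap_castSucc, diffMap]
      rw [this]
      ring
    exact_mod_cast h
  · intro t ht j hj hj0
    rcases mem_ascentTops.mp ht with rfl | ⟨i, rfl, hi⟩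
    · have : (0 : ℝ) < f (Fin.last (n + 1)) := by linarith
      exact_mod_cast this
    · rcases hj.eq_or_lt with rfl | h
      · exact hj0
      · have h1 : (0 : ℝ) < x i.castSucc :=
          lt_of_lt_of_le (by exact_mod_cast hj0) (hle i.castSucc j (by
            simp only [Fin.lt_def, Fin.le_def, Fin.val_castSucc, Fin.val_succ] at h ⊢
            omega))
        have h2 := hx i
        rw [div_le_div_iff₀ (hpos _) (hpos _), hi] at h2
        push_cast at h2
        -- With `s i.succ = s i.castSucc + 1`, the cone inequality exceeds the comparison of the
        -- coordinates scaled by `s i.castSucc` by the positive term `x i.castSucc`.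
        have h3 : x i.castSucc < x i.succ := by
          have : x i.castSucc * s i.castSucc < x i.succ * s i.castSucc := by nlinarith
          exact lt_of_mul_lt_mul_right this (hpos _).le
        have h4 := hstep i
        have : (0 : ℝ) < f i.succ.castSucc := by linarith
        exact_mod_cast this

theorem Admissible.mem {s : Fin (n + 1) → ℕ} (hs : IsZeroOneSeq s) {f : Fin (n + 2) → ℕ}
    (hf : Admissible (ascentTops s) (s (Fin.last n) + 1) f) :
    (fun i => (f i : ℤ)) ∈ latticePoints (simplexA s) := by
  set y : Fin (n + 1) → ℕ := fun i => ∑ j ∈ Finset.Iic i.castSucc, f j with hy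
  have hzero : y 0 = f (Fin.castSucc 0) := by
    have : Finset.Iic (Fin.castSucc (0 : Fin (n + 1))) = {Fin.castSucc 0} := by
      ext j
      simp
    rw [hy]
    dsimp only
    rw [this, Finset.sum_singleton]
  have hstep : ∀ i : Fin n, y i.succ = y i.castSucc + f i.succ.castSucc := by
    intro i
    have : Finset.Iic i.succ.castSucc = insert i.succ.castSucc (Finset.Iic i.castSucc.castSucc) := by
      ext j
      simp only [Finset.mem_Iic, Finset.mem_insert, Fin.le_def, Fin.ext_iff, Fin.val_castSucc,
        Fin.val_succ]
      omega
    rw [hy]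
    dsimp only
    rw [this, Finset.sum_insert (by simp [Fin.le_def]), add_comm]
  have hlast : y (Fin.last n) + f (Fin.last (n + 1)) = s (Fin.last n) + 1 := by
    rw [← hf.sum_eq]
    have : (Finset.univ : Finset (Fin (n + 2))) =
        insert (Fin.last (n + 1)) (Finset.Iic (Fin.last n).castSucc) := by
      ext j
      have := j.isLt
      simp only [Finset.mem_Iic, Finset.mem_insert, Fin.le_def, Fin.ext_iff, Fin.val_castSucc,
        Fin.val_last, Finset.mem_univ, true_iff]
      omega
    rw [this, Finset.sum_insert (by simp [Fin.le_def]), add_comm]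
  have hys : ∀ i, y i ≤ s i := hf.sum_Iic_le hs
  have hpos : ∀ i, (0 : ℝ) < s i := fun i => by exact_mod_cast hs.pos i
  refine ⟨fun i => y i, ⟨⟨by positivity, fun i => ?_⟩, Nat.cast_le.mpr (hys _)⟩, ?_⟩
  · rw [div_le_div_iff₀ (hpos _) (hpos _)]
    beta_reduce
    norm_cast
    rw [hstep i]
    have h1 := hs.le_succ i
    have h2 := hs.succ_le i
    rcases (by omega : s i.succ = s i.castSucc ∨ s i.succ = s i.castSucc + 1) with h | h
    · rw [h]
      exact Nat.mul_le_mul_right _ (Nat.le_add_right _ _)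
    · rw [h, mul_add, mul_one, add_mul]
      -- What remains at an ascent is that the partial sum is at most `f * s`, with `f` the new
      -- coordinate. If the partial sum is nonzero, then `f` is at least 1, and the partial sum is
      -- at most `s`.
      refine Nat.add_le_add_left ?_ _
      rcases Nat.eq_zero_or_pos (y i.castSucc) with h0 | h0
      · rw [h0]; exact Nat.zero_le _
      · obtain ⟨j, hj, hj'⟩ := Finset.exists_ne_zero_of_sum_ne_zero h0.ne'
        have h3 := hf.pos _ (succ_castSucc_mem_ascentTops.mpr h) j
          ((Finset.mem_Iic.mp hj).trans (by simp [Fin.le_def])) (Nat.pos_of_ne_zero hj')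
        exact (hys _).trans (Nat.le_mul_of_pos_left _ h3)
  · funext i
    dsimp only
    rw [Int.cast_natCast]
    induction i using Fin.lastCases with
    | last =>
      rw [homogenize_diffMap_last]
      have : (y (Fin.last n) : ℝ) + f (Fin.last (n + 1)) = s (Fin.last n) + 1 := by
        exact_mod_cast hlast
      linarith
    | cast i =>
      cases i using Fin.cases with
      | zero => rw [homogenize_diffMap_zero, hzero]
      | succ i => rw [homogenize_diffMap_succ, hstep i]; push_cast; ring

end

/-! ### Minimal pairs of lecture hall multisets. -/

section

variable {n : ℕ} {s : Fin (n + 1) → ℕ}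

/-- The multiplicity vector as an element of the lexicographic order. -/
def vec (I : LHMultiset s) : Lex (Fin (n + 2) → ℤ) := toLex (mult I.1)

theorem vec_injective : Function.Injective (vec (s := s)) := by
  intro I J h
  have h' : mult I.1 = mult J.1 := toLex.injective h
  exact Subtype.ext (Multiset.ext.mpr fun i => Int.ofNat_inj.mp (congrFun h' i))

/-- The multiplicities of a lecture hall multiset as natural numbers. -/
def cnt (I : LHMultiset s) : Fin (n + 2) → ℕ := fun i => I.1.count i

theorem cnt_injective : Function.Injective (cnt (s := s)) := fun _ _ h =>
  Subtype.ext (Multiset.ext.mpr (congrFun h))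

theorem cnt_admissible (hs : IsZeroOneSeq s) (I : LHMultiset s) :
    Admissible (ascentTops s) (s (Fin.last n) + 1) (cnt I) :=
  admissible_of_mem hs I.2

theorem exists_cnt_eq (hs : IsZeroOneSeq s) {f : Fin (n + 2) → ℕ}
    (hf : Admissible (ascentTops s) (s (Fin.last n) + 1) f) : ∃ I : LHMultiset s, cnt I = f := by
  have h : ∀ i, (∑ j, Multiset.replicate (f j) j).count i = f i := by
    intro i
    simp only [Multiset.count_sum', Multiset.count_replicate]
    rw [Finset.sum_ite_eq' Finset.univ i]
    simp
  refine ⟨⟨∑ j, Multiset.replicate (f j) j, ?_⟩, funext h⟩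
  have h' : mult (∑ j, Multiset.replicate (f j) j) = fun i => (f i : ℤ) :=
    funext fun i => congrArg _ (h i)
  rw [h']
  exact hf.mem hs

theorem vec_lt_of_cnt {I J : LHMultiset s} {p : Fin (n + 2)} (h : ∀ j < p, cnt J j = cnt I j)
    (hp : cnt J p < cnt I p) : vec J < vec I :=
  ⟨p, fun j hj => congrArg Nat.cast (h j hj), Int.ofNat_lt.mpr hp⟩

theorem lexLE_of_vec_le {I J : LHMultiset s} (h : vec J ≤ vec I) : LexLE (cnt J) (cnt I) := by
  intro i hi
  by_contra! hc
  exact absurd h (not_le.mpr (vec_lt_of_cnt (fun j hj => (hi j hj).symm) hc))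

theorem cnt_multiunion (C : Multiset (LHMultiset s)) (i : Fin (n + 2)) :
    (multiunion C).count i = (C.map fun I => cnt I i).sum := by
  induction C using Multiset.induction with
  | empty => simp [multiunion]
  | cons I C ih =>
    simp only [multiunion, Multiset.map_cons, Multiset.sum_cons, Multiset.count_add] at ih ⊢
    rw [ih]
    rfl

theorem multiunion_pair (I J : LHMultiset s) : multiunion {I, J} = I.1 + J.1 := by
  simp [multiunion]

theorem multiunion_add (C D : Multiset (LHMultiset s)) :
    multiunion (C + D) = multiunion C + multiunion D := by
  simp [multiunion]

/-! The order on collections. -/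

theorem sortedVectors_lt {C D : Multiset (LHMultiset s)} {I : LHMultiset s} (hI : I ∈ C)
    (h : ∀ J ∈ D, vec J < vec I) : sortedVectors D < sortedVectors C := by
  have hC : vec I ∈ sortedVectors C :=
    (Multiset.mem_sort _).mpr (Multiset.mem_map_of_mem (fun I => toLex (mult I.1)) hI)
  have hD : ∀ v ∈ sortedVectors D, v < vec I := by
    intro v hv
    obtain ⟨J, hJ, rfl⟩ := Multiset.mem_map.mp ((Multiset.mem_sort _).mp hv)
    exact h J hJ
  have hs : (sortedVectors C).Pairwise (· ≥ ·) := Multiset.pairwise_sort _ _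
  revert hC hD hs
  generalize sortedVectors C = l
  generalize sortedVectors D = l'
  intro hC hD hs
  cases l with
  | nil => simp at hC
  | cons a l =>
    cases l' with
    | nil => exact List.nil_lt_cons _ _
    | cons b l' =>
      rw [List.cons_lt_cons_iff]
      left
      refine (hD b (by simp)).trans_le ?_
      rcases List.mem_cons.mp hC with h | h
      · exact h.le
      · exact (List.pairwise_cons.mp hs).1 _ h

theorem minimalCollection_eq_iff {C : Multiset (LHMultiset s)} :
    minimalCollection C = C ↔ IsMinimalCollection C := by
  obtain ⟨h1, h2, h3⟩ := minimalCollection_spec C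
  constructor
  · intro h
    rwa [h] at h3
  · intro h
    by_contra hne
    exact lt_asymm (h _ h1 h2 hne) (h3 _ h1.symm h2.symm (Ne.symm hne))

/-- A member equal to `I` could be cancelled from the multiunion, giving back the same pair; a
member above `I` would make the collection larger than `{I, J}`. The strict inequality at the larger
member is what lex needs. -/
theorem lt_of_mem_minimalCollection {I J L : LHMultiset s}
    (h : minimalCollection {I, J} ≠ {I, J}) (hJI : vec J ≤ vec I)
    (hL : L ∈ minimalCollection {I, J}) : vec L < vec I := by
  obtain ⟨h1, h2, h3⟩ := minimalCollection_spec {I, J}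
  obtain ⟨M, hM⟩ : ∃ M, minimalCollection {I, J} = {L, M} := by
    obtain ⟨D, hD⟩ := Multiset.exists_cons_of_mem hL
    rw [hD, Multiset.card_cons] at h1
    have : D.card = 1 := by simpa using h1
    obtain ⟨M, rfl⟩ := Multiset.card_eq_one.mp this
    exact ⟨M, hD⟩
  rw [hM] at h h2 h3
  by_contra hc
  rcases (not_lt.mp hc).eq_or_lt with h' | h'
  · have := vec_injective h'
    subst this
    rw [multiunion_pair, multiunion_pair] at h2
    exact h (by rw [Subtype.ext (add_left_cancel h2)])
  · have h4 : sortedVectors {I, J} < sortedVectors {L, M} := by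
      refine sortedVectors_lt (I := L) (by simp) fun K hK => ?_
      simp only [Multiset.insert_eq_cons, Multiset.mem_cons, Multiset.mem_singleton] at hK
      rcases hK with rfl | rfl
      · exact h'
      · exact hJI.trans_lt h'
    exact lt_asymm h4 (h3 _ (by simp) h2.symm (Ne.symm h))

/-- Two vectors strictly below `vec I` cannot add up to twice `vec I`. This is why the initial
monomials are square-free. -/
theorem isMinimalCollection_self (I : LHMultiset s) : IsMinimalCollection {I, I} := by
  rw [← minimalCollection_eq_iff]
  by_contra h
  obtain ⟨h1, h2, -⟩ := minimalCollection_spec {I, I}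
  obtain ⟨L, M, hLM⟩ := Multiset.card_eq_two.mp (h1.trans (by simp))
  have hL := lt_of_mem_minimalCollection h le_rfl (L := L) (by rw [hLM]; simp)
  have hM := lt_of_mem_minimalCollection h le_rfl (L := M) (by rw [hLM]; simp)
  rw [hLM, multiunion_pair, multiunion_pair] at h2
  have h3 : vec L + vec M = vec I + vec I := by
    have : mult L.1 + mult M.1 = mult I.1 + mult I.1 := by
      funext i
      have := congrArg (Multiset.count i) h2
      rw [Multiset.count_add, Multiset.count_add] at this
      simp only [mult, Pi.add_apply]
      exact_mod_cast this
    exact congrArg toLex this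
  exact (add_lt_add hL hM).ne h3

theorem isBalanced_of_isMinimalCollection (hs : IsZeroOneSeq s) {I J : LHMultiset s}
    (hJI : vec J ≤ vec I) (hne : I ≠ J) (h : IsMinimalCollection {I, J}) :
    IsBalanced (ascentTops s) (cnt I) (cnt J) := by
  by_contra hb
  obtain ⟨i, j, hij, hi, hj, hf, hg, q, hqi, hq, hq'⟩ := exists_shift (cnt_admissible hs I)
    (cnt_admissible hs J) (lexLE_of_vec_le hJI) (cnt_injective.ne hne) hb
  obtain ⟨I', hI'⟩ := exists_cnt_eq hs hf
  obtain ⟨J', hJ'⟩ := exists_cnt_eq hs hg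
  rw [← hJ'] at hq hq'
  have hJlt : vec J' < vec I := vec_lt_of_cnt hq hq'
  have hIlt : vec I' < vec I := by
    refine vec_lt_of_cnt (p := i) (fun l hl => ?_) ?_
    · rw [hI', shift, if_neg hl.ne, if_neg (hl.trans hij).ne, Nat.sub_zero, Nat.add_zero]
    · rw [hI', shift, if_pos rfl, if_neg hij.ne]
      omega
  have hlt : sortedVectors {I', J'} < sortedVectors {I, J} := by
    refine sortedVectors_lt (I := I) (by simp) fun K hK => ?_
    simp only [Multiset.insert_eq_cons, Multiset.mem_cons, Multiset.mem_singleton] at hK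
    rcases hK with rfl | rfl
    · exact hIlt
    · exact hJlt
  refine lt_asymm hlt (h _ (by simp) ?_ fun h' => hlt.ne (by rw [h']))
  rw [multiunion_pair, multiunion_pair]
  ext l
  have h1 : cnt I' l + cnt J' l = cnt I l + cnt J l := by
    rw [hI', hJ']
    simp only [shift]
    split_ifs with h1 h2 h2
    · exact absurd (h1 ▸ h2) hij.ne
    · subst h1; omega
    · subst h2; omega
    · rfl
  rw [Multiset.count_add, Multiset.count_add]
  exact h1

theorem exists_sorted_family {k : ℕ} (C : Multiset (LHMultiset s)) (hk : C.card = k) :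
    ∃ c : Fin k → LHMultiset s, (∀ a b, a ≤ b → vec (c b) ≤ vec (c a)) ∧
      Finset.univ.val.map c = C := by
  classical
  let r : LHMultiset s → LHMultiset s → Prop := fun I J => vec J ≤ vec I
  have : IsTrans _ r := ⟨fun _ _ _ h1 h2 => le_trans h2 h1⟩
  have : Std.Antisymm r := ⟨fun _ _ h1 h2 => vec_injective (le_antisymm h2 h1)⟩
  have : Std.Total r := ⟨fun I J => le_total (vec J) (vec I)⟩
  have hlen : (C.sort r).length = k := (Multiset.length_sort r).trans hk
  subst hlen
  refine ⟨(C.sort r).get, fun a b hab => ?_, ?_⟩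
  · rcases hab.eq_or_lt with rfl | h
    · exact le_rfl
    · exact List.pairwise_iff_get.mp (Multiset.pairwise_sort C r) a b h
  · rw [Fin.univ_val_map, List.ofFn_get, Multiset.sort_eq]

/-- A collection all of whose pairs are minimal is determined by its size and its multiunion. -/
theorem eq_of_pairwise_minimal (hs : IsZeroOneSeq s) {C D : Multiset (LHMultiset s)}
    (hcard : C.card = D.card) (hu : multiunion C = multiunion D)
    (hC : ∀ I J, {I, J} ≤ C → IsMinimalCollection {I, J})
    (hD : ∀ I J, {I, J} ≤ D → IsMinimalCollection {I, J}) : C = D := by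
  obtain ⟨c, hc, hc'⟩ := exists_sorted_family C rfl
  obtain ⟨d, hd, hd'⟩ := exists_sorted_family D hcard.symm
  have hpair : ∀ (e : Fin C.card → LHMultiset s) (a b : Fin C.card), a ≠ b →
      {e a, e b} ≤ Finset.univ.val.map e := fun e a b hab => by
    have h : ({a, b} : Multiset (Fin C.card)) ≤ Finset.univ.val := by
      rw [Multiset.le_iff_subset (by simpa using hab)]
      exact fun x _ => Finset.mem_univ_val x
    simpa using Multiset.map_le_map (f := e) h
  have hbal : ∀ e : Fin C.card → LHMultiset s, (∀ a b, a ≤ b → vec (e b) ≤ vec (e a)) →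
      (∀ I J, {I, J} ≤ Finset.univ.val.map e → IsMinimalCollection {I, J}) →
      ∀ a b, a ≤ b → cnt (e a) ≠ cnt (e b) → IsBalanced (ascentTops s) (cnt (e a)) (cnt (e b)) := by
    intro e he hmin a b hab hne
    have h1 : e a ≠ e b := fun h => hne (congrArg cnt h)
    exact isBalanced_of_isMinimalCollection hs (he a b hab) h1
      (hmin _ _ (hpair e a b fun h => h1 (congrArg e h)))
  have hsum : ∀ i, ∑ a, cnt (c a) i = ∑ a, cnt (d a) i := by
    intro i
    have h := congrArg (Multiset.count i) hu
    rw [cnt_multiunion, cnt_multiunion, ← hc', ← hd', Multiset.map_map, Multiset.map_map] at h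
    exact h
  have h := eq_of_balanced (C := fun a => cnt (c a)) (D := fun a => cnt (d a))
    (card_ascentTops_lt hs) (fun a => cnt_admissible hs _) (fun a => cnt_admissible hs _)
    (fun a b hab => lexLE_of_vec_le (hc a b hab)) (fun a b hab => lexLE_of_vec_le (hd a b hab))
    (hbal c hc fun I J h => hC I J (hc' ▸ h)) (hbal d hd fun I J h => hD I J (hd' ▸ h)) hsum
  have hcd : c = d := funext fun a => cnt_injective (congrFun h a)
  rw [← hc', ← hd', hcd]

end

open MvPolynomial

/-! Kernels of monomial maps. -/

section Monomial

variable {σ K G H : Type*} [Field K] [AddCommGroup G] [AddCommGroup H]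

theorem aeval_single_monomial (w : σ → G) (e : σ →₀ ℕ) (c : K) :
    aeval (fun i => (AddMonoidAlgebra.single (w i) (1 : K) : AddMonoidAlgebra K G))
      (monomial e c) = AddMonoidAlgebra.single (e.sum fun i k => k • w i) c := by
  have h : ∀ t : Finset σ, (∏ i ∈ t, (AddMonoidAlgebra.single (w i) (1 : K) :
      AddMonoidAlgebra K G) ^ e i) = AddMonoidAlgebra.single (∑ i ∈ t, e i • w i) 1 := by
    classical
    intro t
    induction t using Finset.induction_on with
    | empty => simp [AddMonoidAlgebra.one_def]
    | insert a t ha ih =>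
      rw [Finset.prod_insert ha, Finset.sum_insert ha, ih, AddMonoidAlgebra.single_pow,
        AddMonoidAlgebra.single_mul_single, one_pow, one_mul]
  rw [aeval_monomial, Finsupp.prod, h, Finsupp.sum]
  simp [AddMonoidAlgebra.single_mul_single]

/-- The coefficient of the image at the weight of `e` is zero, so another term of the same weight
must cancel that of `e`. -/
theorem exists_ne_mem_support_of_aeval_eq_zero {w : σ → G} {f : MvPolynomial σ K}
    (hf : aeval (fun i => (AddMonoidAlgebra.single (w i) (1 : K) : AddMonoidAlgebra K G)) f = 0)
    {e : σ →₀ ℕ} (he : e ∈ f.support) :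
    ∃ e' ∈ f.support, e' ≠ e ∧ (e'.sum fun i k => k • w i) = e.sum fun i k => k • w i := by
  classical
  by_contra! hc
  have h1 := congrArg (fun x => x.coeff (e.sum fun i k => k • w i)) hf
  rw [f.as_sum, map_sum, AddMonoidAlgebra.coeff_sum, Finsupp.finsetSum_apply,
    Finset.sum_eq_single e] at h1
  · rw [aeval_single_monomial] at h1
    simp at h1
    exact mem_support_iff.mp he h1
  · intro b hb hbe
    rw [aeval_single_monomial]
    simp [hc b hb hbe]
  · exact fun h => absurd he h

theorem ker_aeval_single_comp (L : G →+ H) (hL : Function.Injective L) (w : σ → G) :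
    RingHom.ker (aeval (fun i => (AddMonoidAlgebra.single (L (w i)) (1 : K) :
        AddMonoidAlgebra K H)) : MvPolynomial σ K →ₐ[K] AddMonoidAlgebra K H) =
      RingHom.ker (aeval (fun i => (AddMonoidAlgebra.single (w i) (1 : K) :
        AddMonoidAlgebra K G)) : MvPolynomial σ K →ₐ[K] AddMonoidAlgebra K G) := by
  have h : (aeval (fun i => (AddMonoidAlgebra.single (L (w i)) (1 : K) :
      AddMonoidAlgebra K H)) : MvPolynomial σ K →ₐ[K] AddMonoidAlgebra K H) =
      (AddMonoidAlgebra.mapDomainAlgHom K K L).comp (aeval fun i =>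
        (AddMonoidAlgebra.single (w i) (1 : K) : AddMonoidAlgebra K G)) := by
    ext i
    simp
  ext f
  rw [RingHom.mem_ker, RingHom.mem_ker, h, AlgHom.comp_apply]
  exact map_eq_zero_iff _ (AddMonoidAlgebra.mapDomain_injective hL)

end Monomial

theorem exists_monomialOrder {σ : Type} [Finite σ] {L : Type*} [LinearOrder L] {v : σ → L}
    (hv : Function.Injective v) : ∃ m : MonomialOrder.{0, 0} σ, ∀ (a b : σ →₀ ℕ) (c : σ),
      (∀ d, v c < v d → a d = b d) → a c < b c → m.toSyn a < m.toSyn b := by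
  -- `MonomialOrder.lex` compares at the smallest index first, so the order is reversed to make
  -- large values of `v` decisive.
  let : LinearOrder σ := LinearOrder.lift' (fun x => OrderDual.toDual (v x))
    (OrderDual.toDual.injective.comp hv)
  refine ⟨MonomialOrder.lex, fun a b c h hc => ?_⟩
  rw [MonomialOrder.lex_lt_iff]
  exact ⟨c, fun d hd => h d hd, hc⟩

/-! ### Fibres of the toric map, the comparison of the two toric ideals, and the term order. -/

section

variable {n : ℕ} {s : Fin (n + 1) → ℕ} {K : Type*} [Field K]

theorem finite_lhMultiset (hs : IsZeroOneSeq s) : Finite (LHMultiset s) := by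
  have hlt : ∀ (I : LHMultiset s) i, cnt I i < s (Fin.last n) + 1 + 1 := fun I i => by
    rw [← (cnt_admissible hs I).sum_eq, Nat.lt_succ_iff]
    exact Finset.single_le_sum (f := cnt I) (fun _ _ => Nat.zero_le _) (Finset.mem_univ i)
  refine Finite.of_injective (fun I i => (⟨cnt I i, hlt I i⟩ : Fin (s (Fin.last n) + 1 + 1)))
    fun I J h => cnt_injective (funext fun i => ?_)
  exact congrArg Fin.val (congrFun h i)

theorem collectionMonomial_eq (C : Multiset (LHMultiset s)) :
    collectionMonomial K C = monomial (Multiset.toFinsupp C) 1 := by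
  induction C using Multiset.induction with
  | empty => simp [collectionMonomial]
  | cons I C ih =>
    rw [collectionMonomial] at ih ⊢
    rw [Multiset.map_cons, Multiset.prod_cons, ih, ← Multiset.singleton_add,
      Multiset.toFinsupp_add, Multiset.toFinsupp_singleton, X, monomial_mul, one_mul]

/-- The exponent vector in the definition of the toric ideal of `simplexA s`. -/
def weight (I : LHMultiset s) : Fin (n + 3) → ℤ := Fin.snoc (α := fun _ => ℤ) (mult I.1) 1

theorem mem_toricIdeal_labelA (hs : IsZeroOneSeq s) {f : MvPolynomial (LHMultiset s) K} :
    f ∈ toricIdeal K (labelA s hs) ↔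
      aeval (fun I => (AddMonoidAlgebra.single (weight I) (1 : K) :
        AddMonoidAlgebra K (Fin (n + 3) → ℤ))) f = 0 := Iff.rfl

theorem sum_weight (e : LHMultiset s →₀ ℕ) :
    (e.sum fun I k => k • weight I) = Fin.snoc (α := fun _ => ℤ)
      (mult (multiunion (Finsupp.toMultiset e))) ((Finsupp.toMultiset e).card : ℤ) := by
  induction e using Finsupp.induction_linear with
  | zero =>
    funext i
    induction i using Fin.lastCases <;> simp [multiunion, mult]
  | add e e' h h' =>
    rw [Finsupp.sum_add_index' (by simp) (fun _ _ _ => add_smul _ _ _), h, h', map_add,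
      multiunion_add, Multiset.card_add]
    funext i
    induction i using Fin.lastCases <;> simp [mult]
  | single I k =>
    rw [Finsupp.sum_single_index (by simp), Finsupp.toMultiset_single]
    funext i
    induction i using Fin.lastCases <;> simp [multiunion, mult, weight, Multiset.map_nsmul,
      Multiset.sum_nsmul]

theorem sum_weight_eq_iff {C D : Multiset (LHMultiset s)} :
    ((Multiset.toFinsupp C).sum fun I k => k • weight I) =
      ((Multiset.toFinsupp D).sum fun I k => k • weight I) ↔
      C.card = D.card ∧ multiunion C = multiunion D := by
  rw [sum_weight, sum_weight, Multiset.toFinsupp_toMultiset, Multiset.toFinsupp_toMultiset]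
  constructor
  · intro h
    refine ⟨?_, Multiset.ext.mpr fun i => ?_⟩
    · simpa using congrFun h (Fin.last _)
    · simpa [mult] using congrFun h i.castSucc
  · rintro ⟨h1, h2⟩
    rw [h1, h2]

theorem binomials_subset_toricIdeal (hs : IsZeroOneSeq s) :
    binomials K s ⊆ (toricIdeal K (labelA s hs) : Set (MvPolynomial (LHMultiset s) K)) := by
  rintro f ⟨I, J, -, rfl⟩
  obtain ⟨h1, h2, -⟩ := minimalCollection_spec {I, J}
  rw [SetLike.mem_coe, mem_toricIdeal_labelA, map_sub, collectionMonomial_eq,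
    collectionMonomial_eq, aeval_single_monomial, aeval_single_monomial,
    sum_weight_eq_iff.mpr ⟨h1, h2⟩, sub_self]

theorem diffMap_add {R : Type*} [Ring R] (x y : Fin (n + 1) → R) :
    diffMap (x + y) = diffMap x + diffMap y := by
  funext i
  have h : (Fin.cons 0 (x + y) : Fin (n + 2) → R) i.castSucc =
      (Fin.cons 0 x : Fin (n + 2) → R) i.castSucc + (Fin.cons 0 y : Fin (n + 2) → R) i.castSucc := by
    generalize i.castSucc = j
    cases j using Fin.cases <;> simp
  simp only [diffMap, Pi.add_apply, h]
  abel

/-- The linear extension of `(x, 1) ↦ (homogenize s (diffMap x), 1)`. -/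
def homogenizeHom (s : Fin (n + 1) → ℕ) : (Fin (n + 2) → ℤ) →+ (Fin (n + 3) → ℤ) :=
  AddMonoidHom.mk' (fun y => Fin.snoc (α := fun _ => ℤ) (Fin.snoc (α := fun _ => ℤ)
    (diffMap (Fin.init y)) (((s (Fin.last n) : ℤ) + 1) * y (Fin.last _) -
      ∑ i, diffMap (Fin.init y) i)) (y (Fin.last _))) <| by
    intro y z
    have h : diffMap (Fin.init (y + z)) = diffMap (Fin.init y) + diffMap (Fin.init z) :=
      diffMap_add (Fin.init y) (Fin.init z)
    funext i
    induction i using Fin.lastCases with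
    | last => simp
    | cast i =>
      induction i using Fin.lastCases with
      | last =>
        simp only [h, Pi.add_apply, Fin.snoc_castSucc, Fin.snoc_last, Finset.sum_add_distrib]
        ring
      | cast i => simp [h]

theorem homogenizeHom_injective : Function.Injective (homogenizeHom s) := by
  intro y z h
  have hl : y (Fin.last _) = z (Fin.last _) := by
    simpa [homogenizeHom] using congrFun h (Fin.last _)
  have hd : diffMap (Fin.init y) = diffMap (Fin.init z) := by
    funext i
    simpa [homogenizeHom] using congrFun h i.castSucc.castSucc
  have hi : Fin.init y = Fin.init z :=
    homogenize_diffMap_injective s (congrArg (homogenize s) hd)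
  rw [← Fin.snoc_init_self y, ← Fin.snoc_init_self z, hi, hl]

/-- The extra coordinate 1 turns the affine map between the two polytopes into an injective additive
map of exponents, which does not change the kernel. -/
theorem toricIdeal_labelP (hs : IsZeroOneSeq s) :
    toricIdeal K (labelP s hs) = toricIdeal K (labelA s hs) := by
  rw [toricIdeal, toricIdeal,
    ← ker_aeval_single_comp (homogenizeHom s) homogenizeHom_injective]
  have h : ∀ I, homogenizeHom s (Fin.snoc (α := fun _ => ℤ) ((labelP s hs I).1) 1) =
      Fin.snoc (α := fun _ => ℤ) ((labelA s hs I).1) 1 := by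
    intro I
    have h1 : (labelA s hs I).1 = homogenize s (diffMap (labelP s hs I).1) := by
      have : latticeEquiv s (labelP s hs I) = labelA s hs I := by simp [labelP]
      rw [← this]
      rfl
    rw [h1]
    simp [homogenizeHom, homogenize]
  simp only [h]

/-- A monomial order for which the non-minimal pairs are the larger ones. -/
theorem exists_monomialOrder_minimalCollection_lt (hs : IsZeroOneSeq s) :
    ∃ m : MonomialOrder.{0, 0} (LHMultiset s), ∀ I J : LHMultiset s,
      minimalCollection {I, J} ≠ {I, J} →
        m.toSyn (Multiset.toFinsupp (minimalCollection {I, J})) <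
          m.toSyn (Multiset.toFinsupp {I, J}) := by
  have := finite_lhMultiset hs
  obtain ⟨m, hm⟩ := exists_monomialOrder (vec_injective (s := s))
  refine ⟨m, ?_⟩
  have key : ∀ I J : LHMultiset s, vec J ≤ vec I → minimalCollection {I, J} ≠ {I, J} →
      m.toSyn (Multiset.toFinsupp (minimalCollection {I, J})) <
        m.toSyn (Multiset.toFinsupp {I, J}) := by
    intro I J hJI h
    have h0 : ∀ d, vec I ≤ vec d → (minimalCollection {I, J}).count d = 0 := fun d hd =>
      Multiset.count_eq_zero_of_notMem fun hc =>
        absurd (lt_of_mem_minimalCollection h hJI hc) (not_lt.mpr hd)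
    refine hm _ _ I (fun d hd => ?_) ?_
    · rw [Multiset.toFinsupp_apply, Multiset.toFinsupp_apply, h0 d hd.le,
        Multiset.count_eq_zero_of_notMem]
      simp only [Multiset.insert_eq_cons, Multiset.mem_cons, Multiset.mem_singleton]
      rintro (rfl | rfl)
      · exact lt_irrefl _ hd
      · exact absurd hd (not_lt.mpr hJI)
    · rw [Multiset.toFinsupp_apply, Multiset.toFinsupp_apply, h0 I le_rfl, Multiset.count_pos]
      simp
  intro I J h
  rcases le_total (vec J) (vec I) with h' | h'
  · exact key I J h' h
  · rw [Multiset.pair_comm] at h ⊢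
    exact key J I h' h

section

variable {m : MonomialOrder.{0, 0} (LHMultiset s)}

/-- A collection that is not the smallest one with its size and multiunion contains a
non-minimal pair. -/
theorem exists_nonminimal_pair (hs : IsZeroOneSeq s)
    (hm : ∀ I J : LHMultiset s, minimalCollection {I, J} ≠ {I, J} →
      m.toSyn (Multiset.toFinsupp (minimalCollection {I, J})) <
        m.toSyn (Multiset.toFinsupp {I, J}))
    {C D : Multiset (LHMultiset s)} (hcard : D.card = C.card)
    (hu : multiunion D = multiunion C)
    (hlt : m.toSyn (Multiset.toFinsupp D) < m.toSyn (Multiset.toFinsupp C)) :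
    ∃ I J, {I, J} ≤ C ∧ minimalCollection {I, J} ≠ {I, J} := by
  by_contra! hc
  obtain ⟨E, ⟨hE1, hE2⟩, hmin⟩ := WellFounded.has_min
    (InvImage.wf (fun E => m.toSyn (Multiset.toFinsupp E)) (wellFounded_lt (α := m.syn)))
    {E : Multiset (LHMultiset s) | E.card = C.card ∧ multiunion E = multiunion C} ⟨C, rfl, rfl⟩
  -- `E` is the least collection of the fibre. Replacing a non-minimal pair in it would give a
  -- smaller one, so all pairs of `E` are minimal, like those of `C`.
  have hE : C = E := by
    refine eq_of_pairwise_minimal hs hE1.symm hE2.symm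
      (fun I J h => minimalCollection_eq_iff.mp (hc I J h)) fun I J h => ?_
    rw [← minimalCollection_eq_iff]
    by_contra hne
    obtain ⟨h1, h2, -⟩ := minimalCollection_spec {I, J}
    obtain ⟨R, rfl⟩ := Multiset.le_iff_exists_add.mp h
    refine hmin (minimalCollection {I, J} + R) ⟨?_, ?_⟩ ?_
    · rw [← hE1, Multiset.card_add, Multiset.card_add, h1]
    · rw [← hE2, multiunion_add, multiunion_add, h2]
    · simp only [InvImage, map_add]
      exact add_lt_add_left (hm I J hne) _
  exact hmin D ⟨hcard, hu⟩ (hE ▸ hlt)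

end

end

/-! ### The reduced Gröbner basis. -/

section

variable {n : ℕ} {s : Fin (n + 1) → ℕ} (K : Type*) [Field K]
  {m : MonomialOrder.{0, 0} (LHMultiset s)}

theorem degree_binomial (hm : ∀ I J : LHMultiset s, minimalCollection {I, J} ≠ {I, J} →
      m.toSyn (Multiset.toFinsupp (minimalCollection {I, J})) <
        m.toSyn (Multiset.toFinsupp {I, J}))
    {I J : LHMultiset s} (h : minimalCollection {I, J} ≠ {I, J}) :
    m.degree (collectionMonomial K {I, J} - collectionMonomial K (minimalCollection {I, J})) =
        Multiset.toFinsupp {I, J} ∧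
      m.Monic (collectionMonomial K {I, J} -
        collectionMonomial K (minimalCollection {I, J})) := by
  classical
  have hlt : m.toSyn (m.degree (collectionMonomial K (minimalCollection {I, J}))) <
      m.toSyn (m.degree (collectionMonomial K {I, J})) := by
    rw [collectionMonomial_eq, collectionMonomial_eq, m.degree_monomial, m.degree_monomial]
    simpa using hm I J h
  constructor
  · rw [m.degree_sub_of_lt hlt, collectionMonomial_eq, m.degree_monomial]
    simp
  · rw [MonomialOrder.Monic, m.leadingCoeff_sub_of_lt hlt, collectionMonomial_eq,
      m.leadingCoeff_monomial]

theorem leadingTerm_binomial (hm : ∀ I J : LHMultiset s, minimalCollection {I, J} ≠ {I, J} →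
      m.toSyn (Multiset.toFinsupp (minimalCollection {I, J})) <
        m.toSyn (Multiset.toFinsupp {I, J}))
    {I J : LHMultiset s} (h : minimalCollection {I, J} ≠ {I, J}) :
    m.leadingTerm (collectionMonomial K {I, J} -
      collectionMonomial K (minimalCollection {I, J})) = collectionMonomial K {I, J} := by
  obtain ⟨h1, h2⟩ := degree_binomial K hm h
  rw [MonomialOrder.leadingTerm, h2.leadingCoeff_eq_one, h1, collectionMonomial_eq]

theorem image_leadingTerm_binomials
    (hm : ∀ I J : LHMultiset s, minimalCollection {I, J} ≠ {I, J} →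
      m.toSyn (Multiset.toFinsupp (minimalCollection {I, J})) <
        m.toSyn (Multiset.toFinsupp {I, J})) :
    m.leadingTerm '' binomials K s = {f | ∃ I J : LHMultiset s,
      minimalCollection {I, J} ≠ {I, J} ∧ f = collectionMonomial K {I, J}} := by
  ext f
  constructor
  · rintro ⟨_, ⟨I, J, h, rfl⟩, rfl⟩
    exact ⟨I, J, h, leadingTerm_binomial K hm h⟩
  · rintro ⟨I, J, h, rfl⟩
    exact ⟨_, ⟨I, J, h, rfl⟩, leadingTerm_binomial K hm h⟩

theorem finite_binomials (hs : IsZeroOneSeq s) : (binomials K s).Finite := by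
  have := finite_lhMultiset hs
  refine (Set.finite_range fun p : LHMultiset s × LHMultiset s =>
    collectionMonomial K {p.1, p.2} -
      collectionMonomial K (minimalCollection {p.1, p.2})).subset ?_
  rintro f ⟨I, J, -, rfl⟩
  exact ⟨(I, J), rfl⟩

theorem span_leadingTerm_binomials (hs : IsZeroOneSeq s)
    (hm : ∀ I J : LHMultiset s, minimalCollection {I, J} ≠ {I, J} →
      m.toSyn (Multiset.toFinsupp (minimalCollection {I, J})) <
        m.toSyn (Multiset.toFinsupp {I, J})) :
    Ideal.span (m.leadingTerm '' binomials K s) =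
      initialIdeal m (toricIdeal K (labelA s hs)) := by
  refine le_antisymm (Ideal.span_mono (Set.image_mono (binomials_subset_toricIdeal hs))) ?_
  rw [initialIdeal, Ideal.span_le]
  rintro _ ⟨f, hf, rfl⟩
  rcases eq_or_ne f 0 with rfl | hf0
  · rw [m.leadingTerm_zero]
    exact zero_mem _
  obtain ⟨e, he, hne, hw⟩ := exists_ne_mem_support_of_aeval_eq_zero
    ((mem_toricIdeal_labelA hs).mp hf) (m.degree_mem_support hf0)
  have hlt : m.toSyn e < m.toSyn (m.degree f) :=
    lt_of_le_of_ne (m.le_degree he) (m.toSyn.injective.ne hne)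
  rw [← Finsupp.toMultiset_toFinsupp e, ← Finsupp.toMultiset_toFinsupp (m.degree f)] at hlt hw
  obtain ⟨h1, h2⟩ := sum_weight_eq_iff.mp hw
  obtain ⟨I, J, hle, hIJ⟩ := exists_nonminimal_pair hs hm h1 h2 hlt
  obtain ⟨R, hR⟩ := Multiset.le_iff_exists_add.mp hle
  have hdeg : m.degree f = Multiset.toFinsupp R + Multiset.toFinsupp {I, J} := by
    rw [← map_add, add_comm R, ← hR, Finsupp.toMultiset_toFinsupp]
  have hterm : m.leadingTerm f =
      monomial (Multiset.toFinsupp R) (m.leadingCoeff f) * collectionMonomial K {I, J} := by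
    rw [collectionMonomial_eq, monomial_mul, mul_one, ← hdeg, MonomialOrder.leadingTerm]
  rw [SetLike.mem_coe, hterm, image_leadingTerm_binomials K hm]
  exact Ideal.mul_mem_left _ _ (Ideal.subset_span ⟨I, J, hIJ, rfl⟩)

theorem eq_of_toFinsupp_le {C D : Multiset (LHMultiset s)} (hcard : D.card ≤ C.card)
    (h : Multiset.toFinsupp C ≤ Multiset.toFinsupp D) : C = D :=
  Multiset.eq_of_le_of_card_le (Multiset.le_iff_count.mpr h) hcard

theorem isReducedGroebnerBasis_binomials (hs : IsZeroOneSeq s)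
    (hm : ∀ I J : LHMultiset s, minimalCollection {I, J} ≠ {I, J} →
      m.toSyn (Multiset.toFinsupp (minimalCollection {I, J})) <
        m.toSyn (Multiset.toFinsupp {I, J})) :
    IsReducedGroebnerBasis m (binomials K s) (toricIdeal K (labelA s hs)) where
  finite := finite_binomials K hs
  subset := binomials_subset_toricIdeal hs
  span_eq := span_leadingTerm_binomials K hs hm
  monic := by
    rintro _ ⟨I, J, h, rfl⟩
    exact (degree_binomial K hm h).2
  minimal := by
    classical
    rintro _ ⟨I, J, h, rfl⟩ hmem
    rw [leadingTerm_binomial K hm h] at hmem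
    have hsub : m.leadingTerm '' (binomials K s \ {collectionMonomial K {I, J} -
        collectionMonomial K (minimalCollection {I, J})}) ⊆
        (fun e => monomial e (1 : K)) '' {e | ∃ I' J' : LHMultiset s,
          e = Multiset.toFinsupp {I', J'} ∧ ({I', J'} : Multiset (LHMultiset s)) ≠ {I, J}} := by
      rintro _ ⟨_, ⟨⟨I', J', h', rfl⟩, hne⟩, rfl⟩
      refine ⟨Multiset.toFinsupp {I', J'}, ⟨I', J', rfl, fun hc => hne ?_⟩, ?_⟩
      · rw [hc]
        rfl
      · rw [leadingTerm_binomial K hm h', collectionMonomial_eq]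
    have hmem' := Ideal.span_mono hsub hmem
    rw [collectionMonomial_eq, mem_ideal_span_monomial_image] at hmem'
    -- Divisibility between monomials of the same degree 2 is equality.
    obtain ⟨_, ⟨I', J', rfl, hne⟩, hle⟩ := hmem' (Multiset.toFinsupp {I, J}) (by simp)
    exact hne (eq_of_toFinsupp_le (by simp) hle)
  reduced := by
    classical
    rintro _ ⟨I, J, h, rfl⟩ _ ⟨I', J', h', rfl⟩ c hc hcne hle
    rw [(degree_binomial K hm h).1] at hcne
    rw [(degree_binomial K hm h').1] at hle
    have hc' : c = Multiset.toFinsupp (minimalCollection {I, J}) := by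
      rw [mem_support_iff, coeff_sub, collectionMonomial_eq, collectionMonomial_eq,
        coeff_monomial, coeff_monomial, if_neg (Ne.symm hcne)] at hc
      by_contra hne
      rw [if_neg (Ne.symm hne)] at hc
      simp at hc
    obtain ⟨h1, h2, h3⟩ := minimalCollection_spec {I, J}
    rw [hc'] at hle
    -- For the same reason, an initial monomial dividing the tail would be the tail, whose
    -- collection is minimal.
    have := eq_of_toFinsupp_le (by rw [h1]; simp) hle
    rw [← this] at h3
    exact h' (minimalCollection_eq_iff.mpr h3)

theorem isHomogeneous_collectionMonomial (C : Multiset (LHMultiset s)) :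
    (collectionMonomial K C).IsHomogeneous C.card := by
  rw [collectionMonomial_eq]
  refine isHomogeneous_monomial _ ?_
  rw [← Multiset.toFinsupp_sum_eq]
  rfl

theorem squarefree_collectionMonomial {I J : LHMultiset s} (hne : I ≠ J) :
    Squarefree (collectionMonomial K {I, J}) := by
  have h : collectionMonomial K {I, J} = X I * X J := by simp [collectionMonomial]
  have hp : ∀ L : LHMultiset s, Irreducible (X L : MvPolynomial (LHMultiset s) K) :=
    fun L => X_prime.irreducible
  rw [h, squarefree_mul_iff]
  refine ⟨(hp I).isRelPrime_iff_not_dvd.mpr fun hd => hne ?_, (hp I).squarefree,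
    (hp J).squarefree⟩
  simpa using hd

end

end LectureHall

theorem mainTheorem3 {K : Type*} [Field K] {n : ℕ} (s : Fin (n + 1) → ℕ)
    (hs : LectureHall.IsZeroOneSeq s) :
    LectureHall.toricIdeal K (LectureHall.labelP s hs) =
        LectureHall.toricIdeal K (LectureHall.labelA s hs) ∧
      ∃ m : MonomialOrder.{0, 0} (LectureHall.LHMultiset s),
        LectureHall.IsReducedGroebnerBasis m (LectureHall.binomials K s)
            (LectureHall.toricIdeal K (LectureHall.labelA s hs)) ∧
        (∀ g ∈ LectureHall.binomials K s, g.IsHomogeneous 2) ∧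
        (∀ I J : LectureHall.LHMultiset s, LectureHall.minimalCollection {I, J} ≠ {I, J} →
          m.leadingTerm (LectureHall.collectionMonomial K {I, J} -
              LectureHall.collectionMonomial K (LectureHall.minimalCollection {I, J})) =
            LectureHall.collectionMonomial K {I, J} ∧
          Squarefree (LectureHall.collectionMonomial K {I, J})) ∧
        LectureHall.initialIdeal m (LectureHall.toricIdeal K (LectureHall.labelA s hs)) =
          Ideal.span {f | ∃ I J : LectureHall.LHMultiset s,
            LectureHall.minimalCollection {I, J} ≠ {I, J} ∧
            f = LectureHall.collectionMonomial K {I, J}} := by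
  open LectureHall in
  obtain ⟨m, hm⟩ := exists_monomialOrder_minimalCollection_lt hs
  refine ⟨toricIdeal_labelP hs, m, isReducedGroebnerBasis_binomials K hs hm, ?_, ?_, ?_⟩
  · rintro _ ⟨I, J, -, rfl⟩
    have h := isHomogeneous_collectionMonomial K (minimalCollection {I, J})
    rw [(minimalCollection_spec {I, J}).1] at h
    exact (isHomogeneous_collectionMonomial K {I, J}).sub h
  · intro I J h
    refine ⟨leadingTerm_binomial K hm h, squarefree_collectionMonomial K ?_⟩
    rintro rfl
    exact h (minimalCollection_eq_iff.mpr (isMinimalCollection_self I))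
  · rw [← span_leadingTerm_binomials K hs hm, image_leadingTerm_binomials K hm]
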